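/- Let $R$ be an associative ring with unit; all modules are unitary left $R$-modules. An embedding $f:A\to B$ of modules is pure if every finite system of linear equations with coefficients in $R$ and parameters in $f[A]$ that has a solution in $B$ has a solution in $f[A]$. A module $M$ is cotorsion if $\mathrm{Ext}^1_R(F,M)=0$ for every flat module $F$. A module $M$ is $\mathfrak{s}$-torsion if $\mathfrak{s}(M)=M$, where $\mathfrak{s}(M)$ is the kernel of the map $M\cong R\otimes_R M\to I\otimes_R M$ induced by an embedding $R\to I$ of right $R$-modules with $I$ injective (the kernel does not depend on the embedding). A module $E$ is $K^{\mathfrak{s}\text{-}\mathrm{Tor}}$-pure injective if $E$ is $\mathfrak{s}$-torsion and, for every pure embedding $i:X\to Y$ of $\mathfrak{s}$-torsion modules and every homomorphism $h:X\to E$, there is a homomorphism $h':Y\to E$ with $h'i=h$. Let $A$ and $B$ be modules that are either both flat and cotorsion, or both $K^{\mathfrak{s}\text{-}\mathrm{Tor}}$-pure injective. If there are pure embeddings $f:A\to B$ and $g:B\to A$, then $A\cong B$. -/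

import Mathlib

open scoped TensorProduct MulOpposite
open CategoryTheory

universe u v

/-!
Throughout, `R` is an associative ring with unit, a module is a left `R`-module, and a right
`R`-module is a module over `Rᵐᵒᵖ`, the element `n · r` being written `op r • n`.
The size condition `Small.{v} R` says that `R` fits into the universe `v` of the modules.
-/

/-- The balancing relations `(n · r) ⊗ m - n ⊗ (r m)` of the tensor product over `R`. -/
def NCTensor.relations (R : Type u) [Ring R] (N M : Type*) [AddCommGroup N] [Module Rᵐᵒᵖ N]
    [AddCommGroup M] [Module R M] : AddSubgroup (N ⊗[ℤ] M) :=
  AddSubgroup.closure {t | ∃ (n : N) (r : R) (m : M),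
    t = (MulOpposite.op r • n) ⊗ₜ[ℤ] m - n ⊗ₜ[ℤ] (r • m)}

/-- The tensor product `N ⊗_R M` (an abelian group) of a right module `N` and a left module `M`
over a possibly noncommutative ring `R`. -/
abbrev NCTensor (R : Type u) [Ring R] (N M : Type*) [AddCommGroup N] [Module Rᵐᵒᵖ N]
    [AddCommGroup M] [Module R M] : Type _ :=
  (N ⊗[ℤ] M) ⧸ NCTensor.relations R N M

/-- The pure tensor `n ⊗ m` in `N ⊗_R M`. -/
def NCTensor.tmul (R : Type u) [Ring R] {N M : Type*} [AddCommGroup N] [Module Rᵐᵒᵖ N]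
    [AddCommGroup M] [Module R M] (n : N) (m : M) : NCTensor R N M :=
  QuotientAddGroup.mk' (NCTensor.relations R N M) (n ⊗ₜ[ℤ] m)

/-- The additive map `f ⊗ M : N ⊗_R M → N' ⊗_R M`, `n ⊗ m ↦ f n ⊗ m`, induced by a homomorphism
`f : N → N'` of right modules. -/
def NCTensor.rTensor (R : Type u) [Ring R] {N N' : Type*} (M : Type*)
    [AddCommGroup N] [Module Rᵐᵒᵖ N] [AddCommGroup N'] [Module Rᵐᵒᵖ N']
    [AddCommGroup M] [Module R M] (f : N →ₗ[Rᵐᵒᵖ] N') : NCTensor R N M →+ NCTensor R N' M :=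
  QuotientAddGroup.map (NCTensor.relations R N M) (NCTensor.relations R N' M)
    (LinearMap.rTensor M f.toAddMonoidHom.toIntLinearMap).toAddMonoidHom (by
      refine (AddSubgroup.closure_le _).2 ?_
      rintro _ ⟨n, r, m, rfl⟩
      refine AddSubgroup.subset_closure ⟨f n, r, m, ?_⟩
      simp)

/-- A left module `M` is flat if `- ⊗_R M` preserves injectivity of homomorphisms of right
modules. -/
def IsFlatModule (R : Type u) [Ring R] (M : Type v) [AddCommGroup M] [Module R M] : Prop :=
  ∀ ⦃N N' : Type v⦄ [AddCommGroup N] [Module Rᵐᵒᵖ N] [AddCommGroup N'] [Module Rᵐᵒᵖ N']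
    (f : N →ₗ[Rᵐᵒᵖ] N'), Function.Injective f → Function.Injective (NCTensor.rTensor R M f)

/-- A module `M` is cotorsion if `Ext¹_R(F, M) = 0` for every flat module `F`. -/
def IsCotorsionModule (R : Type u) [Ring R] [Small.{v} R] (M : Type v) [AddCommGroup M]
    [Module R M] : Prop :=
  ∀ (F : Type v) [AddCommGroup F] [Module R F], IsFlatModule R F →
    Subsingleton (Abelian.Ext.{v} (ModuleCat.of R F) (ModuleCat.of R M) 1)

/-- An embedding `f : A → B` is pure if every finite system of linear equations
`∑ j, r i j * X j = f (a i)` with parameters in `f[A]` that has a solution in `B` has a solution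
in `f[A]`. -/
def IsPureEmbedding {R : Type u} [Ring R] {A B : Type v} [AddCommGroup A] [Module R A]
    [AddCommGroup B] [Module R B] (f : A →ₗ[R] B) : Prop :=
  Function.Injective f ∧
    ∀ (m n : ℕ) (r : Fin m → Fin n → R) (a : Fin m → A),
      (∃ y : Fin n → B, ∀ i, ∑ j, r i j • y j = f (a i)) →
        ∃ x : Fin n → A, ∀ i, ∑ j, r i j • f (x j) = f (a i)

/-- `E` is `K_𝓜`-injective, for a class `K` of modules and a class `𝓜` of homomorphisms (of which
only those between modules in `K` count): `E` is in `K`, and for every `f : A → B` in `𝓜` with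
`A` and `B` in `K`, every homomorphism `g : A → E` extends along `f`. -/
def IsRelInjective {R : Type u} [Ring R]
    (K : ∀ (M : Type v) [AddCommGroup M] [Module R M], Prop)
    (𝓜 : ∀ {A B : Type v} [AddCommGroup A] [Module R A] [AddCommGroup B] [Module R B],
      (A →ₗ[R] B) → Prop)
    (E : Type v) [AddCommGroup E] [Module R E] : Prop :=
  K E ∧ ∀ ⦃A B : Type v⦄ [AddCommGroup A] [Module R A] [AddCommGroup B] [Module R B]
    (f : A →ₗ[R] B), K A → K B → 𝓜 f →
      ∀ g : A →ₗ[R] E, ∃ h : B →ₗ[R] E, h ∘ₗ f = g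

/-- The torsion part `𝔰(M)` of a module in the sense of Martsinkovsky and Russell: the value at `R`
of the injective stabilization of `- ⊗_R M`, i.e. the kernel of `M ≅ R ⊗_R M → I ⊗_R M`,
`m ↦ ι 1 ⊗ m`, for an embedding `ι : R → I` of right modules with `I` injective. The kernel is the
same for all such `ι`, so asking for all of them avoids a choice. -/
def sTorsionPart (R : Type u) [Ring R] (M : Type v) [AddCommGroup M] [Module R M] : Set M :=
  {m | ∀ ⦃I : Type v⦄ [AddCommGroup I] [Module Rᵐᵒᵖ I] (ι : R →ₗ[Rᵐᵒᵖ] I),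
    Module.Injective Rᵐᵒᵖ I → Function.Injective ι → NCTensor.tmul R (ι 1) m = 0}

/-- `M` is an `𝔰`-torsion module: `𝔰(M) = M`. -/
def IsSTorsionModule (R : Type u) [Ring R] (M : Type v) [AddCommGroup M] [Module R M] : Prop :=
  sTorsionPart R M = Set.univ

/-- `E` is `K^{𝔰-Tor}`-pure injective: `E` is `𝔰`-torsion and injective relative to pure embeddings
of `𝔰`-torsion modules. -/
def IsSTorPureInjective (R : Type u) [Ring R] (E : Type v) [AddCommGroup E] [Module R E] : Prop :=
  IsRelInjective (R := R) (fun M _ _ => IsSTorsionModule R M) (fun f => IsPureEmbedding f) E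

/-! Both cases are instances of one statement. Let `K` be a class of modules closed under direct
limits and pure submodules. If `A` and `B` are pure injective in `K` and embed purely in each other,
they are isomorphic (`IsPureLimitClosed.nonempty_linearEquiv`). Flat modules and 𝔰-torsion modules
form such classes. A flat cotorsion module is pure injective among flat modules, because the
cokernel of a pure embedding into a flat module is flat and `Ext¹` from it vanishes.

The pure embeddings `f` and `g` split, so `A ≅ B ⊕ C` with `C` the kernel of a retraction of `g`.
The translates of `C` under `g ∘ f` form a pure copy of `P = C ⊕ C ⊕ ⋯` in `A`, and `f` carries it
into `B`. Let `E` be a hull of `P` in `K`: all pure extensions of `P` in `K` map to `E` over `P`,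
and endomorphisms of `E` over `P` are bijective. Then `E` is a summand of `B`, say `B ≅ E ⊕ D`.
Since `C ⊕ P ≅ P`, also `C ⊕ E ≅ E`. Therefore `A ≅ C ⊕ E ⊕ D ≅ E ⊕ D ≅ B`.

The main work is the hull (`IsPureLimitClosed.exists_hull`). An endomorphism of `A` over `P` with
stable kernel is iterated; the limit is rigid, meaning that its maps over `P` to pure extensions in
`K` are injective. Endomorphisms of a rigid, weakly terminal extension are also surjective. The
stable kernel and the surjectivity both rest on `IsLimitClosed.false_of_adjoin`: their failure would
permit a chain of extensions too long for the set of labels recording it. -/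

namespace NCTensor

/-! ### Tensor products over a noncommutative ring. -/

variable {R : Type u} [Ring R] {N N' M M' : Type*} [AddCommGroup N] [Module Rᵐᵒᵖ N]
  [AddCommGroup N'] [Module Rᵐᵒᵖ N'] [AddCommGroup M] [Module R M] [AddCommGroup M'] [Module R M']

/-- The biadditive map `(n, m) ↦ n ⊗ m`. -/
def mkHom (R : Type u) [Ring R] (N M : Type*) [AddCommGroup N] [Module Rᵐᵒᵖ N]
    [AddCommGroup M] [Module R M] : N →+ M →+ NCTensor R N M :=
  AddMonoidHom.mk' (fun n => AddMonoidHom.mk' (fun m => tmul R n m)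
      (fun m m' => by simp [tmul, TensorProduct.tmul_add]))
    (fun n n' => by ext m; simp [tmul, TensorProduct.add_tmul])

@[simp] theorem mkHom_apply (n : N) (m : M) : mkHom R N M n m = tmul R n m := rfl

theorem tmul_add (n : N) (m m' : M) : tmul R n (m + m') = tmul R n m + tmul R n m' :=
  (mkHom R N M n).map_add m m'

theorem add_tmul (n n' : N) (m : M) : tmul R (n + n') m = tmul R n m + tmul R n' m :=
  DFunLike.congr_fun ((mkHom R N M).map_add n n') m

@[simp] theorem tmul_zero (n : N) : tmul R n (0 : M) = 0 :=
  (mkHom R N M n).map_zero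

@[simp] theorem zero_tmul (m : M) : tmul R (0 : N) m = 0 :=
  DFunLike.congr_fun (mkHom R N M).map_zero m

theorem tmul_sub (n : N) (m m' : M) : tmul R n (m - m') = tmul R n m - tmul R n m' :=
  (mkHom R N M n).map_sub m m'

theorem sub_tmul (n n' : N) (m : M) : tmul R (n - n') m = tmul R n m - tmul R n' m :=
  DFunLike.congr_fun ((mkHom R N M).map_sub n n') m

theorem op_smul_tmul (n : N) (r : R) (m : M) :
    tmul R (MulOpposite.op r • n) m = tmul R n (r • m) := by
  rw [← sub_eq_zero]
  exact (QuotientAddGroup.eq_zero_iff _).2 (AddSubgroup.subset_closure ⟨n, r, m, rfl⟩)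

theorem induction_on {p : NCTensor R N M → Prop} (t : NCTensor R N M) (zero : p 0)
    (tmul : ∀ n m, p (tmul R n m)) (add : ∀ s t, p s → p t → p (s + t)) : p t := by
  induction t using QuotientAddGroup.induction_on with
  | H z =>
    induction z using TensorProduct.induction_on with
    | zero => exact zero
    | tmul n m => exact tmul n m
    | add x y hx hy => exact add _ _ hx hy

theorem hom_ext {G : Type*} [AddCommGroup G] {f g : NCTensor R N M →+ G}
    (h : ∀ n m, f (tmul R n m) = g (tmul R n m)) : f = g := by
  refine DFunLike.ext _ _ fun t => ?_
  induction t using induction_on with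
  | zero => simp
  | tmul n m => exact h n m
  | add s t hs ht => simp [hs, ht]

/-- The additive map induced by a balanced biadditive map. -/
def lift {G : Type*} [AddCommGroup G] (β : N →+ M →+ G)
    (hβ : ∀ n (r : R) m, β (MulOpposite.op r • n) m = β n (r • m)) : NCTensor R N M →+ G :=
  QuotientAddGroup.lift _ (TensorProduct.liftAddHom β (fun z n m => by simp)) (by
    refine (AddSubgroup.closure_le _).2 ?_
    rintro _ ⟨n, r, m, rfl⟩
    simp [hβ])

@[simp] theorem lift_tmul {G : Type*} [AddCommGroup G] (β : N →+ M →+ G)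
    (hβ : ∀ n (r : R) m, β (MulOpposite.op r • n) m = β n (r • m)) (n : N) (m : M) :
    lift β hβ (tmul R n m) = β n m := by
  rfl

@[simp] theorem rTensor_tmul (f : N →ₗ[Rᵐᵒᵖ] N') (n : N) (m : M) :
    rTensor R M f (tmul R n m) = tmul R (f n) m := by
  rfl

/-- The additive map `N ⊗ f : N ⊗_R M → N ⊗_R M'`, `n ⊗ m ↦ n ⊗ f m`. -/
def lTensor (N : Type*) [AddCommGroup N] [Module Rᵐᵒᵖ N] (f : M →ₗ[R] M') :
    NCTensor R N M →+ NCTensor R N M' :=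
  lift ((mkHom R N M').compr₂ (AddMonoidHom.id _) |>.compl₂ f.toAddMonoidHom)
    (fun n r m => by simp [op_smul_tmul])

@[simp] theorem lTensor_tmul (f : M →ₗ[R] M') (n : N) (m : M) :
    lTensor N f (tmul R n m) = tmul R n (f m) := by
  simp [lTensor]

theorem lTensor_comp_apply {M'' : Type*} [AddCommGroup M''] [Module R M''] (g : M' →ₗ[R] M'')
    (f : M →ₗ[R] M') (t : NCTensor R N M) :
    lTensor N g (lTensor N f t) = lTensor N (g ∘ₗ f) t := by
  have : (lTensor N g).comp (lTensor N f) = lTensor N (g ∘ₗ f) := hom_ext (by simp)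
  exact DFunLike.congr_fun this t

theorem lTensor_rTensor (f : N →ₗ[Rᵐᵒᵖ] N') (g : M →ₗ[R] M') (t : NCTensor R N M) :
    lTensor N' g (rTensor R M f t) = rTensor R M' f (lTensor N g t) := by
  have : (lTensor N' g).comp (rTensor R M f) = (rTensor R M' f).comp (lTensor N g) :=
    hom_ext (by simp)
  exact DFunLike.congr_fun this t

/-- The formal sum `∑ w(y) · y` is sent to `∑ w(y) ⊗ θ(y)`. -/
noncomputable def sumTmul {Y : Type*} (R : Type u) [Ring R] (N : Type*) [AddCommGroup N]
    [Module Rᵐᵒᵖ N] {M : Type*} [AddCommGroup M] [Module R M] (θ : Y → M) :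
    (Y →₀ N) →+ NCTensor R N M :=
  Finsupp.liftAddHom (fun y => (mkHom R N M).flip (θ y))

@[simp] theorem sumTmul_single {Y : Type*} (θ : Y → M) (y : Y) (n : N) :
    sumTmul R N θ (Finsupp.single y n) = tmul R n (θ y) := by
  simp [sumTmul]

theorem sumTmul_congr {Y : Type*} {θ θ' : Y → M} {w : Y →₀ N}
    (h : ∀ y ∈ w.support, θ y = θ' y) : sumTmul R N θ w = sumTmul R N θ' w := by
  simp only [sumTmul, Finsupp.liftAddHom_apply]
  exact Finsupp.sum_congr fun y hy => by rw [h y hy]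

theorem sumTmul_mapDomain {X Y : Type*} (θ : Y → M) (f : X → Y) (w : X →₀ N) :
    sumTmul R N θ (w.mapDomain f) = sumTmul R N (θ ∘ f) w := by
  have : (sumTmul R N θ).comp (Finsupp.mapDomain.addMonoidHom f) = sumTmul R N (θ ∘ f) := by
    ext; simp
  exact DFunLike.congr_fun this w

theorem lTensor_sumTmul {Y : Type*} (f : M →ₗ[R] M') (θ : Y → M) (w : Y →₀ N) :
    lTensor N f (sumTmul R N θ w) = sumTmul R N (f ∘ θ) w := by
  have : (lTensor N f).comp (sumTmul R N θ) = sumTmul R N (f ∘ θ) := by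
    ext; simp
  exact DFunLike.congr_fun this w

theorem exists_sumTmul_eq (t : NCTensor R N M) : ∃ w : M →₀ N, sumTmul R N id w = t := by
  induction t using induction_on with
  | zero => exact ⟨0, map_zero _⟩
  | tmul n m => exact ⟨Finsupp.single m n, by simp⟩
  | add s t hs ht =>
    obtain ⟨w, rfl⟩ := hs
    obtain ⟨w', rfl⟩ := ht
    exact ⟨w + w', map_add _ _ _⟩

section Vanishing

variable {Y : Type v} [AddCommGroup Y] [Module R Y]

/-- The formal sums whose vanishing in the tensor product is enforced by finitely many linear
relations in `Y`. -/
noncomputable def finitelyVanishing (R : Type u) [Ring R] (N : Type*) [AddCommGroup N]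
    [Module Rᵐᵒᵖ N] (Y : Type v) [AddCommGroup Y] [Module R Y] : AddSubgroup (Y →₀ N) where
  carrier := {w | ∃ H : Finset (Y →₀ R), (∀ h ∈ H, Finsupp.linearCombination R id h = 0) ∧
    ∀ (X : Type v) [AddCommGroup X] [Module R X] (θ : Y → X),
      (∀ h ∈ H, Finsupp.linearCombination R θ h = 0) → sumTmul R N θ w = 0}
  zero_mem' := ⟨∅, by simp, by simp⟩
  add_mem' := by
    classical
    rintro w w' ⟨H, hH, h⟩ ⟨H', hH', h'⟩
    refine ⟨H ∪ H', fun k hk => ?_, fun X _ _ θ hθ => ?_⟩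
    · rcases Finset.mem_union.1 hk with hk | hk
      exacts [hH k hk, hH' k hk]
    · rw [map_add, h X θ fun k hk => hθ k (Finset.mem_union_left _ hk),
        h' X θ fun k hk => hθ k (Finset.mem_union_right _ hk), add_zero]
  neg_mem' := by
    rintro w ⟨H, hH, h⟩
    exact ⟨H, hH, fun X _ _ θ hθ => by rw [map_neg, h X θ hθ, neg_zero]⟩

theorem single_add_sub_mem (n : N) (y y' : Y) :
    Finsupp.single (y + y') n - (Finsupp.single y n + Finsupp.single y' n) ∈
      finitelyVanishing R N Y := by
  refine ⟨{Finsupp.single (y + y') 1 - (Finsupp.single y 1 + Finsupp.single y' 1)}, by simp, ?_⟩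
  intro X _ _ θ hθ
  have : θ (y + y') = θ y + θ y' := by simpa [sub_eq_zero] using hθ
  simp [this, tmul_add]

theorem single_smul_sub_mem (n : N) (r : R) (y : Y) :
    Finsupp.single y (MulOpposite.op r • n) - Finsupp.single (r • y) n ∈
      finitelyVanishing R N Y := by
  refine ⟨{Finsupp.single y r - Finsupp.single (r • y) 1}, by simp, ?_⟩
  intro X _ _ θ hθ
  have : r • θ y = θ (r • y) := by simpa [sub_eq_zero] using hθ
  simp [op_smul_tmul, this]

/-- A vanishing element of `N ⊗_R Y` vanishes because of finitely many linear relations in `Y`. -/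
theorem exists_relations_of_sumTmul_eq_zero {w : Y →₀ N} (hw : sumTmul R N id w = 0) :
    ∃ H : Finset (Y →₀ R), (∀ h ∈ H, Finsupp.linearCombination R id h = 0) ∧
      ∀ (X : Type v) [AddCommGroup X] [Module R X] (θ : Y → X),
        (∀ h ∈ H, Finsupp.linearCombination R θ h = 0) → sumTmul R N θ w = 0 := by
  -- The quotient by `V` satisfies the defining relations of `N ⊗ Y`, so the projection onto it
  -- factors through `sumTmul`.
  let V := finitelyVanishing R N Y
  let β : N →+ Y →+ (Y →₀ N) ⧸ V :=
    AddMonoidHom.mk' (fun n => AddMonoidHom.mk'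
      (fun y => QuotientAddGroup.mk' V (Finsupp.single y n)) (fun y y' => by
        rw [← map_add, ← sub_eq_zero, ← map_sub]
        exact (QuotientAddGroup.eq_zero_iff _).2 (single_add_sub_mem n y y')))
      (fun n n' => by ext y; simp)
  let F : NCTensor R N Y →+ (Y →₀ N) ⧸ V := lift β (fun n r y => by
    rw [← sub_eq_zero]
    exact (QuotientAddGroup.eq_zero_iff _).2 (single_smul_sub_mem n r y))
  have hF : F.comp (sumTmul R N id) = QuotientAddGroup.mk' V := by
    ext y n
    simp [F, β]
  have h0 : QuotientAddGroup.mk' V w = 0 := by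
    rw [← hF, AddMonoidHom.comp_apply, hw, map_zero]
  exact (QuotientAddGroup.eq_zero_iff _).1 h0

end Vanishing

end NCTensor

/-! ### Purity, tensor products and flatness. -/

section Pure

variable {R : Type u} [Ring R] {X Y Z : Type v} [AddCommGroup X] [Module R X]
  [AddCommGroup Y] [Module R Y] [AddCommGroup Z] [Module R Z]

theorem IsPureEmbedding.exists_solution {f : X →ₗ[R] Y} (hf : IsPureEmbedding f) {ι κ : Type*}
    [Fintype ι] [Fintype κ] (r : ι → κ → R) (a : ι → X) (y : κ → Y)
    (h : ∀ i, ∑ j, r i j • y j = f (a i)) : ∃ x : κ → X, ∀ i, ∑ j, r i j • x j = a i := by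
  let eι := Fintype.equivFin ι
  let eκ := Fintype.equivFin κ
  obtain ⟨x, hx⟩ := hf.2 _ _ (fun i j => r (eι.symm i) (eκ.symm j)) (fun i => a (eι.symm i))
    ⟨fun j => y (eκ.symm j), fun i => by
      rw [← h, ← eκ.symm.sum_comp (fun j => r (eι.symm i) j • y j)]⟩
  refine ⟨fun j => x (eκ j), fun i => hf.1 ?_⟩
  have := hx (eι i)
  simp only [Equiv.symm_apply_apply] at this
  rw [← this, ← eκ.symm.sum_comp, map_sum]
  simp

theorem isPureEmbedding_of_forall_exists {f : X →ₗ[R] Y} (hf : Function.Injective f)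
    (h : ∀ (m n : ℕ) (r : Fin m → Fin n → R) (a : Fin m → X) (y : Fin n → Y),
      (∀ i, ∑ j, r i j • y j = f (a i)) → ∃ x : Fin n → X, ∀ i, ∑ j, r i j • x j = a i) :
    IsPureEmbedding f :=
  ⟨hf, fun m n r a ⟨y, hy⟩ => (h m n r a y hy).imp fun x hx i => by
    rw [← hx i, map_sum]; simp⟩

/-- A map that has a retraction over every finite set of elements is a pure embedding. -/
theorem isPureEmbedding_of_locally_split {f : X →ₗ[R] Y}
    (h : ∀ s : Finset X, ∃ g : Y →ₗ[R] X, ∀ x ∈ s, g (f x) = x) : IsPureEmbedding f := by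
  classical
  refine isPureEmbedding_of_forall_exists ?_ ?_
  · intro a b hab
    obtain ⟨g, hg⟩ := h {a, b}
    rw [← hg a (by simp), hab, hg b (by simp)]
  · intro m n r a y hy
    obtain ⟨g, hg⟩ := h (Finset.univ.image a)
    refine ⟨fun j => g (y j), fun i => ?_⟩
    rw [← hg (a i) (by simp), ← hy i]
    simp

theorem isPureEmbedding_of_leftInverse {f : X →ₗ[R] Y} (g : Y →ₗ[R] X)
    (h : ∀ x, g (f x) = x) : IsPureEmbedding f :=
  isPureEmbedding_of_locally_split fun _ => ⟨g, fun x _ => h x⟩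

theorem IsPureEmbedding.comp {g : Y →ₗ[R] Z} {f : X →ₗ[R] Y} (hg : IsPureEmbedding g)
    (hf : IsPureEmbedding f) : IsPureEmbedding (g ∘ₗ f) := by
  refine isPureEmbedding_of_forall_exists (hg.1.comp hf.1) fun m n r a z hz => ?_
  obtain ⟨y, hy⟩ := hg.exists_solution r (fun i => f (a i)) z hz
  exact hf.exists_solution r a y hy

/-- Finitely many relations in the codomain of a pure embedding can be pulled back along a
retraction of sets. -/
theorem IsPureEmbedding.exists_retraction {f : X →ₗ[R] Y} (hf : IsPureEmbedding f)
    (H : Finset (Y →₀ R)) (hH : ∀ h ∈ H, Finsupp.linearCombination R id h = 0) :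
    ∃ θ : Y → X, (∀ x, θ (f x) = x) ∧ ∀ h ∈ H, Finsupp.linearCombination R θ h = 0 := by
  classical
  -- The elements of `s` outside the range of `f` become the unknowns of a linear system; those
  -- inside become its parameters.
  let s : Finset Y := H.biUnion Finsupp.support
  let S : Finset Y := s.filter (fun y => y ∉ Set.range f)
  let σ : Y → X := fun y => if hy : y ∈ Set.range f then hy.choose else 0
  have hσ : ∀ x, σ (f x) = x := fun x => by
    have hy : f x ∈ Set.range f := ⟨x, rfl⟩
    simp only [σ, dif_pos hy]
    exact hf.1 hy.choose_spec
  have key : ∀ (E : Type v) [AddCommGroup E] [Module R E] (θ : Y → E), ∀ h ∈ H,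
      Finsupp.linearCombination R θ h = (∑ y : S, h y • θ y) +
        ∑ y ∈ s.filter (fun y => y ∈ Set.range f), h y • θ y := by
    intro E _ _ θ h hh
    rw [Finsupp.linearCombination_apply, Finsupp.sum_of_support_subset h
      (s := s) (Finset.subset_biUnion_of_mem Finsupp.support hh) _ (by simp),
      ← Finset.sum_filter_not_add_sum_filter s (fun y => y ∈ Set.range f)]
    congr 1
    exact (Finset.sum_coe_sort S (fun y => h y • θ y)).symm
  obtain ⟨x, hx⟩ := hf.exists_solution (fun (h : H) (y : S) => h.1 y)
    (fun h => -∑ y ∈ s.filter (fun y => y ∈ Set.range f), h.1 y • σ y) (fun y => y.1) (by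
      intro h
      have := key Y id h.1 h.2
      rw [hH h.1 h.2] at this
      rw [map_neg, map_sum, eq_neg_iff_add_eq_zero, this]
      congr 1
      refine Finset.sum_congr rfl fun y hy => ?_
      obtain ⟨x, rfl⟩ := (Finset.mem_filter.1 hy).2
      simp [hσ])
  let θ : Y → X := fun y => if hy : y ∈ S then x ⟨y, hy⟩ else σ y
  have hθ : ∀ y ∈ Set.range f, θ y = σ y := fun y hy =>
    dif_neg fun (h : y ∈ S) => (Finset.mem_filter.1 h).2 hy
  refine ⟨θ, fun a => by rw [hθ _ ⟨a, rfl⟩, hσ], fun h hh => ?_⟩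
  rw [key X θ h hh]
  have h1 : ∑ y : S, h y • θ y = ∑ y : S, h y • x y :=
    Finset.sum_congr rfl fun y _ => by simp [θ]
  rw [h1, hx ⟨h, hh⟩, neg_add_eq_zero]
  exact Finset.sum_congr rfl fun y hy => by rw [hθ y (Finset.mem_filter.1 hy).2]

/-- Tensoring a pure embedding gives an injective map. -/
theorem IsPureEmbedding.lTensor_injective {f : X →ₗ[R] Y} (hf : IsPureEmbedding f)
    (N : Type*) [AddCommGroup N] [Module Rᵐᵒᵖ N] :
    Function.Injective (NCTensor.lTensor N f) := by
  refine (injective_iff_map_eq_zero _).2 fun t ht => ?_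
  obtain ⟨w, rfl⟩ := NCTensor.exists_sumTmul_eq t
  rw [NCTensor.lTensor_sumTmul, Function.comp_id, ← Function.id_comp f,
    ← NCTensor.sumTmul_mapDomain] at ht
  obtain ⟨H, hH, h⟩ := NCTensor.exists_relations_of_sumTmul_eq_zero ht
  obtain ⟨θ, hθ, hθH⟩ := hf.exists_retraction H hH
  have := h X θ hθH
  rw [NCTensor.sumTmul_mapDomain] at this
  rwa [show (θ ∘ f : X → X) = id from funext hθ] at this

/-- `N ⊗ X` embeds in `N ⊗ Y` by purity, and `N ⊗ Y` in `N' ⊗ Y` by flatness; this composite factors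
through `N' ⊗ X`. -/
theorem IsFlatModule.of_pure {f : X →ₗ[R] Y} (hf : IsPureEmbedding f) (hY : IsFlatModule R Y) :
    IsFlatModule R X := by
  intro N N' _ _ _ _ i hi
  refine (injective_iff_map_eq_zero _).2 fun t ht => ?_
  apply hf.lTensor_injective N
  apply hY i hi
  rw [← NCTensor.lTensor_rTensor, ht, map_zero, map_zero, map_zero]

theorem IsSTorsionModule.of_pure {f : X →ₗ[R] Y} (hf : IsPureEmbedding f)
    (hY : IsSTorsionModule R Y) : IsSTorsionModule R X := by
  refine Set.eq_univ_of_forall fun x I _ _ ι hI hι => ?_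
  apply hf.lTensor_injective I
  rw [NCTensor.lTensor_tmul, map_zero]
  exact (Set.eq_univ_iff_forall.1 hY (f x)) ι hI hι

/-- Right exactness: modulo the range of `lTensor N f`, the class of `n ⊗ y` depends only on `q y`,
so lifting along a set-theoretic section of `q` is well defined on `N ⊗ Z`. -/
theorem NCTensor.mem_range_lTensor {f : X →ₗ[R] Y} {q : Y →ₗ[R] Z} (hq : Function.Surjective q)
    (hfq : ∀ y, q y = 0 → y ∈ Set.range f) {N : Type*} [AddCommGroup N] [Module Rᵐᵒᵖ N]
    {t : NCTensor R N Y} (ht : lTensor N q t = 0) : t ∈ (lTensor N f).range := by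
  let V := (lTensor N f).range
  have hV : ∀ n y, q y = 0 → tmul R n y ∈ V := fun n y hy => by
    obtain ⟨x, rfl⟩ := hfq y hy
    exact ⟨tmul R n x, by simp⟩
  have hV' : ∀ n y y', q y = q y' →
      QuotientAddGroup.mk' V (tmul R n y) = QuotientAddGroup.mk' V (tmul R n y') := by
    intro n y y' h
    rw [← sub_eq_zero, ← map_sub, ← tmul_sub]
    exact (QuotientAddGroup.eq_zero_iff _).2 (hV n (y - y') (by rw [map_sub, h, sub_self]))
  let s := Function.surjInv hq
  have hs : ∀ z, q (s z) = z := Function.surjInv_eq hq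
  let β : N →+ Z →+ NCTensor R N Y ⧸ V :=
    AddMonoidHom.mk' (fun n => AddMonoidHom.mk' (fun z => QuotientAddGroup.mk' V (tmul R n (s z)))
      (fun z z' => by
        rw [← map_add, ← tmul_add]
        exact hV' _ _ _ (by simp [hs])))
      (fun n n' => by ext z; simp [add_tmul])
  let F : NCTensor R N Z →+ NCTensor R N Y ⧸ V := lift β (fun n r z => by
    change QuotientAddGroup.mk' V _ = QuotientAddGroup.mk' V _
    rw [op_smul_tmul]
    exact hV' _ _ _ (by simp [hs]))
  have hF : F.comp (lTensor N q) = QuotientAddGroup.mk' V := hom_ext fun n y => by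
    simpa [F, β] using hV' n _ _ (hs _)
  refine (QuotientAddGroup.eq_zero_iff t).1 ?_
  change QuotientAddGroup.mk' V t = 0
  rw [← hF, AddMonoidHom.comp_apply, ht, map_zero]

theorem NCTensor.mem_range_rTensor {N N' N'' : Type*} [AddCommGroup N] [Module Rᵐᵒᵖ N]
    [AddCommGroup N'] [Module Rᵐᵒᵖ N'] [AddCommGroup N''] [Module Rᵐᵒᵖ N'']
    {f : N →ₗ[Rᵐᵒᵖ] N'} {q : N' →ₗ[Rᵐᵒᵖ] N''} (hq : Function.Surjective q)
    (hfq : ∀ y, q y = 0 → y ∈ Set.range f)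
    {t : NCTensor R N' X} (ht : rTensor R X q t = 0) : t ∈ (rTensor R X f).range := by
  let V := (rTensor R X f).range
  have hV : ∀ n x, q n = 0 → tmul R n x ∈ V := fun n x hy => by
    obtain ⟨n, rfl⟩ := hfq n hy
    exact ⟨tmul R n x, by simp⟩
  have hV' : ∀ n n' x, q n = q n' →
      QuotientAddGroup.mk' V (tmul R n x) = QuotientAddGroup.mk' V (tmul R n' x) := by
    intro n n' x h
    rw [← sub_eq_zero, ← map_sub, ← sub_tmul]
    exact (QuotientAddGroup.eq_zero_iff _).2 (hV (n - n') x (by rw [map_sub, h, sub_self]))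
  let s := Function.surjInv hq
  have hs : ∀ z, q (s z) = z := Function.surjInv_eq hq
  let β : N'' →+ X →+ NCTensor R N' X ⧸ V :=
    AddMonoidHom.mk' (fun n => AddMonoidHom.mk' (fun x => QuotientAddGroup.mk' V (tmul R (s n) x))
      (fun x x' => by rw [← map_add, ← tmul_add]))
      (fun n n' => by
        ext x
        simp only [AddMonoidHom.mk'_apply, AddMonoidHom.add_apply]
        rw [← map_add, ← add_tmul]
        exact hV' _ _ _ (by simp [hs]))
  let F : NCTensor R N'' X →+ NCTensor R N' X ⧸ V := lift β (fun n r x => by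
    change QuotientAddGroup.mk' V _ = QuotientAddGroup.mk' V _
    rw [← op_smul_tmul]
    exact hV' _ _ _ (by simp [hs]))
  have hF : F.comp (rTensor R X q) = QuotientAddGroup.mk' V := hom_ext fun n x => by
    simpa [F, β] using hV' _ _ x (hs (q n))
  refine (QuotientAddGroup.eq_zero_iff t).1 ?_
  change QuotientAddGroup.mk' V t = 0
  rw [← hF, AddMonoidHom.comp_apply, ht, map_zero]

theorem NCTensor.lTensor_surjective {q : Y →ₗ[R] Z} (hq : Function.Surjective q)
    (N : Type*) [AddCommGroup N] [Module Rᵐᵒᵖ N] : Function.Surjective (lTensor N q) := by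
  intro t
  induction t using induction_on with
  | zero => exact ⟨0, map_zero _⟩
  | tmul n m =>
    obtain ⟨y, rfl⟩ := hq m
    exact ⟨tmul R n y, by simp⟩
  | add s t hs ht =>
    obtain ⟨a, rfl⟩ := hs
    obtain ⟨b, rfl⟩ := ht
    exact ⟨a + b, map_add _ _ _⟩

/-- The cokernel of a pure embedding into a flat module is flat. -/
theorem IsFlatModule.of_pure_quotient {f : X →ₗ[R] Y} (hf : IsPureEmbedding f) {q : Y →ₗ[R] Z}
    (hq : Function.Surjective q) (hfq : Function.Exact f q) (hY : IsFlatModule R Y) :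
    IsFlatModule R Z := by
  intro N N' _ _ _ _ i hi
  refine (injective_iff_map_eq_zero _).2 fun t ht => ?_
  obtain ⟨y, rfl⟩ := NCTensor.lTensor_surjective hq N t
  have hex : ∀ y, q y = 0 → y ∈ Set.range f := fun y => (hfq y).1
  rw [← NCTensor.lTensor_rTensor] at ht
  obtain ⟨x', hx'⟩ := NCTensor.mem_range_lTensor hq hex ht
  let π := (LinearMap.range i).mkQ
  have hπ : ∀ n, π n = 0 → n ∈ Set.range i := fun n hn => by
    simpa [π] using hn
  have hπi : (NCTensor.rTensor R Y π).comp (NCTensor.rTensor R Y i) = 0 :=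
    NCTensor.hom_ext fun n m => by
      have : π (i n) = 0 := by simp [π]
      simp [this]
  -- The image of `x'` over the cokernel of `i` vanishes after passing to `Y`, hence by purity
  -- already in `X`. So `x'` comes from `N ⊗ X`, and flatness of `Y` identifies its source there
  -- with `y`.
  have hx0 : NCTensor.rTensor R X π x' = 0 := by
    apply hf.lTensor_injective
    rw [NCTensor.lTensor_rTensor, hx', map_zero]
    exact DFunLike.congr_fun hπi y
  obtain ⟨x, rfl⟩ := NCTensor.mem_range_rTensor (Submodule.mkQ_surjective _) hπ hx0
  rw [NCTensor.lTensor_rTensor] at hx'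
  rw [← hY i hi hx', NCTensor.lTensor_comp_apply, hfq.linearMap_comp_eq_zero]
  have : NCTensor.lTensor N (0 : X →ₗ[R] Z) = 0 := NCTensor.hom_ext fun n m => by
    simp
  rw [this, AddMonoidHom.zero_apply]

end Pure

/-! ### Direct limits preserve torsion, flatness and purity. -/

/-- `M` with the maps `φ` is the direct limit of the direct system `(G, t)`. -/
structure IsDirectLimit {R : Type*} [Ring R] {ι : Type*} [Preorder ι] {G : ι → Type*}
    [∀ i, AddCommGroup (G i)] [∀ i, Module R (G i)] (t : ∀ i j, i ≤ j → G i →ₗ[R] G j)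
    {M : Type*} [AddCommGroup M] [Module R M] (φ : ∀ i, G i →ₗ[R] M) : Prop where
  trans : ∀ i j k (hij : i ≤ j) (hjk : j ≤ k) x, t j k hjk (t i j hij x) = t i k (hij.trans hjk) x
  comm : ∀ i j (hij : i ≤ j) x, φ j (t i j hij x) = φ i x
  exists_eq : ∀ y, ∃ i x, φ i x = y
  exists_eq_zero : ∀ i x, φ i x = 0 → ∃ j, ∃ hij : i ≤ j, t i j hij x = 0

namespace IsDirectLimit

variable {R : Type u} [Ring R] {ι : Type*} [Preorder ι]
  {G : ι → Type v} [∀ i, AddCommGroup (G i)] [∀ i, Module R (G i)]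
  {t : ∀ i j, i ≤ j → G i →ₗ[R] G j} {M : Type v} [AddCommGroup M] [Module R M]
  {φ : ∀ i, G i →ₗ[R] M}

theorem isSTorsionModule (h : IsDirectLimit t φ) (hG : ∀ i, IsSTorsionModule R (G i)) :
    IsSTorsionModule R M := by
  refine Set.eq_univ_of_forall fun y I _ _ κ hI hκ => ?_
  obtain ⟨i, x, rfl⟩ := h.exists_eq y
  have : NCTensor.tmul R (κ 1) x = 0 := (Set.eq_univ_iff_forall.1 (hG i) x) κ hI hκ
  rw [← NCTensor.lTensor_tmul, this, map_zero]

variable [IsDirectedOrder ι]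

theorem exists_forall_eq_zero (h : IsDirectLimit t φ) (i : ι) (s : Finset (G i))
    (hs : ∀ x ∈ s, φ i x = 0) : ∃ j, ∃ hij : i ≤ j, ∀ x ∈ s, t i j hij x = 0 := by
  classical
  induction s using Finset.induction_on with
  | empty => exact ⟨i, le_rfl, by simp⟩
  | insert a s _ ih =>
    obtain ⟨j, hij, hj⟩ := ih fun x hx => hs x (Finset.mem_insert_of_mem hx)
    obtain ⟨k, hik, hk⟩ := h.exists_eq_zero i a (hs a (Finset.mem_insert_self _ _))
    obtain ⟨l, hjl, hkl⟩ := exists_ge_ge j k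
    refine ⟨l, hij.trans hjl, fun x hx => ?_⟩
    rcases Finset.mem_insert.1 hx with rfl | hx
    · rw [← h.trans i k l hik hkl, hk, map_zero]
    · rw [← h.trans i j l hij hjl, hj x hx, map_zero]

variable [Nonempty ι]

/-- Finitely many relations of a direct limit already hold at some stage. -/
theorem exists_lift (h : IsDirectLimit t φ) (H : Finset (M →₀ R))
    (hH : ∀ r ∈ H, Finsupp.linearCombination R id r = 0) (i : ι) (s : Finset (G i)) :
    ∃ j, ∃ hij : i ≤ j, ∃ θ : M → G j, (∀ x ∈ s, θ (φ i x) = t i j hij x) ∧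
      ∀ r ∈ H, Finsupp.linearCombination R θ r = 0 := by
  classical
  choose a b hab using h.exists_eq
  let Y : Finset M := H.biUnion Finsupp.support ∪ s.image (φ i)
  obtain ⟨j, hj⟩ := Finset.exists_le (insert i (Y.image a))
  have hij : i ≤ j := hj i (Finset.mem_insert_self _ _)
  -- The default `0` is harmless: only the finitely many elements of `Y` matter, and their chosen
  -- stages lie below `j`.
  let θ : M → G j := fun y => if hy : a y ≤ j then t (a y) j hy (b y) else 0
  have hθ : ∀ y ∈ Y, φ j (θ y) = y := fun y hy => by
    have : a y ≤ j := hj _ (Finset.mem_insert_of_mem (Finset.mem_image_of_mem a hy))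
    simp only [θ, dif_pos this, h.comm, hab]
  -- At stage `j` the relations and the values on `s` hold up to finitely many errors that vanish in
  -- `M`; a later stage kills them all.
  obtain ⟨k, hjk, hk⟩ := h.exists_forall_eq_zero j
    (H.image (fun r => Finsupp.linearCombination R θ r) ∪
      s.image (fun x => θ (φ i x) - t i j hij x)) (by
    intro x hx
    rcases Finset.mem_union.1 hx with hx | hx
    · obtain ⟨r, hr, rfl⟩ := Finset.mem_image.1 hx
      rw [← hH r hr, Finsupp.linearCombination_apply, Finsupp.linearCombination_apply,
        map_finsuppSum]
      refine Finsupp.sum_congr fun y hy => ?_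
      rw [map_smul, hθ y (Finset.mem_union_left _ (Finset.mem_biUnion.2 ⟨r, hr, hy⟩)), id]
    · obtain ⟨z, hz, rfl⟩ := Finset.mem_image.1 hx
      rw [map_sub, h.comm, hθ _ (Finset.mem_union_right _ (Finset.mem_image_of_mem _ hz)),
        sub_self])
  refine ⟨k, hij.trans hjk, fun y => t j k hjk (θ y), fun x hx => ?_, fun r hr => ?_⟩
  · have := hk _ (Finset.mem_union_right _ (Finset.mem_image_of_mem _ hx))
    rwa [map_sub, h.trans, sub_eq_zero] at this
  · have := hk _ (Finset.mem_union_left _ (Finset.mem_image_of_mem _ hr))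
    rw [Finsupp.linearCombination_apply, map_finsuppSum] at this
    simpa only [Finsupp.linearCombination_apply, map_smul] using this

theorem exists_lTensor_eq (h : IsDirectLimit t φ) {N : Type*} [AddCommGroup N] [Module Rᵐᵒᵖ N]
    (z : NCTensor R N M) : ∃ i x, NCTensor.lTensor N (φ i) x = z := by
  induction z using NCTensor.induction_on with
  | zero => exact ⟨Classical.arbitrary ι, 0, map_zero _⟩
  | tmul n m =>
    obtain ⟨i, x, rfl⟩ := h.exists_eq m
    exact ⟨i, NCTensor.tmul R n x, by simp⟩
  | add y z hy hz =>
    obtain ⟨i, x, rfl⟩ := hy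
    obtain ⟨j, y, rfl⟩ := hz
    obtain ⟨k, hik, hjk⟩ := exists_ge_ge i j
    refine ⟨k, NCTensor.lTensor N (t i k hik) x + NCTensor.lTensor N (t j k hjk) y, ?_⟩
    rw [map_add, NCTensor.lTensor_comp_apply, NCTensor.lTensor_comp_apply,
      show φ k ∘ₗ t i k hik = φ i from LinearMap.ext (h.comm i k hik),
      show φ k ∘ₗ t j k hjk = φ j from LinearMap.ext (h.comm j k hjk)]

theorem exists_lTensor_eq_zero (h : IsDirectLimit t φ) {N : Type*} [AddCommGroup N]
    [Module Rᵐᵒᵖ N] (i : ι) (z : NCTensor R N (G i)) (hz : NCTensor.lTensor N (φ i) z = 0) :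
    ∃ j, ∃ hij : i ≤ j, NCTensor.lTensor N (t i j hij) z = 0 := by
  obtain ⟨w, rfl⟩ := NCTensor.exists_sumTmul_eq z
  rw [NCTensor.lTensor_sumTmul, Function.comp_id, ← Function.id_comp (φ i),
    ← NCTensor.sumTmul_mapDomain] at hz
  obtain ⟨H, hH, hw⟩ := NCTensor.exists_relations_of_sumTmul_eq_zero hz
  obtain ⟨j, hij, θ, hθ, hθH⟩ := h.exists_lift H hH i w.support
  refine ⟨j, hij, ?_⟩
  rw [NCTensor.lTensor_sumTmul, Function.comp_id, ← hw (G j) θ hθH, NCTensor.sumTmul_mapDomain]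
  exact NCTensor.sumTmul_congr fun x hx => (hθ x hx).symm

theorem isFlatModule (h : IsDirectLimit t φ) (hG : ∀ i, IsFlatModule R (G i)) :
    IsFlatModule R M := by
  intro N N' _ _ _ _ f hf
  refine (injective_iff_map_eq_zero _).2 fun z hz => ?_
  obtain ⟨i, x, rfl⟩ := h.exists_lTensor_eq z
  rw [← NCTensor.lTensor_rTensor] at hz
  obtain ⟨j, hij, hj⟩ := h.exists_lTensor_eq_zero i _ hz
  rw [NCTensor.lTensor_rTensor] at hj
  have := hG j f hf (hj.trans (map_zero _).symm)
  rw [← show φ j ∘ₗ t i j hij = φ i from LinearMap.ext (h.comm i j hij),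
    ← NCTensor.lTensor_comp_apply, this, map_zero]

/-- A finite system solved in `M` is finitely many relations in `M`. They lift to some stage, where
purity gives a solution in `P`. -/
theorem isPureEmbedding (h : IsDirectLimit t φ) {P : Type v} [AddCommGroup P] [Module R P]
    {p : ∀ i, P →ₗ[R] G i} (hp : ∀ i, IsPureEmbedding (p i))
    (htp : ∀ i j (hij : i ≤ j) x, t i j hij (p i x) = p j x) {q : P →ₗ[R] M}
    (hq : ∀ i x, φ i (p i x) = q x) : IsPureEmbedding q := by
  classical
  let i := Classical.arbitrary ι
  refine isPureEmbedding_of_forall_exists ?_ ?_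
  · refine (injective_iff_map_eq_zero _).2 fun x hx => ?_
    rw [← hq i] at hx
    obtain ⟨j, hij, hj⟩ := h.exists_eq_zero i _ hx
    rw [htp] at hj
    exact (map_eq_zero_iff _ (hp j).1).1 hj
  · intro m n r a y hy
    let rel : Fin m → (M →₀ R) := fun k =>
      ∑ l, Finsupp.single (y l) (r k l) - Finsupp.single (q (a k)) 1
    obtain ⟨j, hij, θ, hθ, hθH⟩ := h.exists_lift (Finset.univ.image rel) (by
      intro x hx
      obtain ⟨k, -, rfl⟩ := Finset.mem_image.1 hx
      simp [rel, map_sum, hy]) i (Finset.univ.image fun k => p i (a k))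
    refine (hp j).exists_solution r a (fun l => θ (y l)) fun k => ?_
    have h1 := hθH (rel k) (Finset.mem_image_of_mem _ (Finset.mem_univ k))
    have h2 := hθ (p i (a k)) (Finset.mem_image.2 ⟨k, Finset.mem_univ k, rfl⟩)
    rw [hq, htp] at h2
    simpa [rel, map_sum, sub_eq_zero, h2] using h1

end IsDirectLimit

/-! ### Subquotients of a fixed module. -/

/-- The subquotient `D / N` of a module, for `N ≤ D`. -/
abbrev Subquotient {R : Type*} [Ring R] {W : Type*} [AddCommGroup W] [Module R W]
    (D N : Submodule R W) : Type _ :=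
  D ⧸ N.submoduleOf D

namespace Subquotient

variable {R : Type u} [Ring R] {W : Type v} [AddCommGroup W] [Module R W]

/-- The class of an element of `D`. -/
abbrev mk {D : Submodule R W} (N : Submodule R W) : D →ₗ[R] Subquotient D N :=
  (N.submoduleOf D).mkQ

theorem mk_surjective {D : Submodule R W} (N : Submodule R W) :
    Function.Surjective (mk (D := D) N) :=
  Submodule.mkQ_surjective _

theorem mk_eq_zero {D N : Submodule R W} (d : D) : mk N d = 0 ↔ (d : W) ∈ N := by
  rw [mk, Submodule.mkQ_apply, Submodule.Quotient.mk_eq_zero]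
  rfl

/-- The map induced by inclusions. -/
def map {D N D' N' : Submodule R W} (hD : D ≤ D') (hN : N ≤ N') :
    Subquotient D N →ₗ[R] Subquotient D' N' :=
  Submodule.mapQ _ _ (Submodule.inclusion hD) fun _ hx => hN hx

@[simp] theorem map_mk {D N D' N' : Submodule R W} (hD : D ≤ D') (hN : N ≤ N') (d : D) :
    map hD hN (mk N d) = mk N' (Submodule.inclusion hD d) := rfl

/-- This lets Zorn's lemma on pairs of submodules replace transfinite direct systems of abstract
modules. -/
theorem isDirectLimit (c : Set (Submodule R W × Submodule R W))
    {D N : Submodule R W} (hD : ∀ w, w ∈ D ↔ ∃ x ∈ c, w ∈ x.1)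
    (hN : ∀ w, w ∈ N ↔ ∃ x ∈ c, w ∈ x.2) (hc : IsChain (· ≤ ·) c)  :
    IsDirectLimit (ι := c) (G := fun x => Subquotient x.1.1 x.1.2)
      (fun x y (h : x.1 ≤ y.1) => map h.1 h.2)
      (fun x => map (fun w hw => (hD w).2 ⟨x, x.2, hw⟩) (fun w hw => (hN w).2 ⟨x, x.2, hw⟩) :
        ∀ x : c, _ →ₗ[R] Subquotient D N) where
  trans i j k hij hjk x := by
    obtain ⟨x, rfl⟩ := mk_surjective _ x
    rfl
  comm i j hij x := by
    obtain ⟨x, rfl⟩ := mk_surjective _ x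
    rfl
  exists_eq y := by
    obtain ⟨⟨y, hy⟩, rfl⟩ := mk_surjective _ y
    obtain ⟨x, hx, hyx⟩ := (hD y).1 hy
    exact ⟨⟨x, hx⟩, mk _ ⟨y, hyx⟩, rfl⟩
  exists_eq_zero i x hx := by
    obtain ⟨x, rfl⟩ := mk_surjective _ x
    rw [map_mk, mk_eq_zero] at hx
    obtain ⟨k, hk, hxk⟩ := (hN _).1 hx
    rcases hc.total i.2 hk with h | h
    · exact ⟨⟨k, hk⟩, h, by rw [map_mk, mk_eq_zero]; exact hxk⟩
    · exact ⟨i, le_rfl, by rw [map_mk, mk_eq_zero]; exact h.2 hxk⟩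

end Subquotient

/-! ### Adjoining labelled copies of a module, and the Zorn argument. -/

section Labelled

variable {R : Type u} [Ring R] {A : Type v} [AddCommGroup A] [Module R A] {U : Type v}

/-- Set the coordinate at `u` to zero. -/
noncomputable def eraseLinear (R : Type u) [Ring R] (A : Type v) [AddCommGroup A] [Module R A]
    {U : Type v} (u : U) : (U →₀ A) →ₗ[R] (U →₀ A) :=
  LinearMap.id - Finsupp.lsingle u ∘ₗ Finsupp.lapply u

theorem eraseLinear_of_eq_zero {u : U} {w : U →₀ A} (h : w u = 0) : eraseLinear R A u w = w := by
  simp [eraseLinear, h]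

@[simp] theorem eraseLinear_single_self (u : U) (a : A) :
    eraseLinear R A u (Finsupp.single u a) = 0 := by
  simp [eraseLinear]

theorem eraseLinear_apply_ne {u s : U} (h : s ≠ u) (w : U →₀ A) :
    eraseLinear R A u w s = w s := by
  simp [eraseLinear, h.symm]

/-- The submodule `D` enlarged by a new coordinate `u`. -/
noncomputable def adjoinLabel (D : Submodule R (U →₀ A)) (u : U) : Submodule R (U →₀ A) :=
  D.comap (eraseLinear R A u)

variable {D N : Submodule R (U →₀ A)}

/-- The extension to `adjoinLabel D u` of a map on a quotient of `D` by the coordinate at `u`. -/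
noncomputable def adjoinMap (f : Subquotient D N →ₗ[R] A) (u : U) : adjoinLabel D u →ₗ[R] A :=
  f ∘ₗ Subquotient.mk N ∘ₗ (eraseLinear R A u).restrict (fun _ h => h) +
    Finsupp.lapply u ∘ₗ (adjoinLabel D u).subtype

/-- The relations that make the enlarged module isomorphic to the target of `f`. -/
noncomputable def adjoinRel (f : Subquotient D N →ₗ[R] A) (u : U) : Submodule R (U →₀ A) :=
  (LinearMap.ker (adjoinMap f u)).map (adjoinLabel D u).subtype

theorem le_adjoinLabel {u : U} (hu : ∀ d ∈ D, d u = 0) : D ≤ adjoinLabel D u := fun d hd => by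
  change eraseLinear R A u d ∈ D
  rwa [eraseLinear_of_eq_zero (hu d hd)]

theorem single_mem_adjoinLabel (u : U) (a : A) : Finsupp.single u a ∈ adjoinLabel D u := by
  change eraseLinear R A u _ ∈ D
  simp

theorem adjoinMap_of_mem (f : Subquotient D N →ₗ[R] A) {u : U} (hu : ∀ d ∈ D, d u = 0)
    (d : D) : adjoinMap f u ⟨d, le_adjoinLabel hu d.2⟩ = f (Subquotient.mk N d) := by
  simp only [adjoinMap, LinearMap.add_apply, LinearMap.comp_apply, Submodule.subtype_apply,
    Finsupp.lapply_apply, hu d d.2, add_zero]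
  congr 2
  exact Subtype.ext (eraseLinear_of_eq_zero (hu d d.2))

theorem adjoinMap_single (f : Subquotient D N →ₗ[R] A) (u : U) (a : A) :
    adjoinMap f u ⟨Finsupp.single u a, single_mem_adjoinLabel u a⟩ = a := by
  have : (eraseLinear R A u).restrict (fun _ h => h)
      (⟨Finsupp.single u a, single_mem_adjoinLabel u a⟩ : adjoinLabel D u) = (0 : D) :=
    Subtype.ext (eraseLinear_single_self u a)
  simp only [adjoinMap, LinearMap.add_apply, LinearMap.comp_apply, this, map_zero, zero_add]
  simp

theorem mem_adjoinRel (f : Subquotient D N →ₗ[R] A) {u : U} (x : adjoinLabel D u) :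
    (x : U →₀ A) ∈ adjoinRel f u ↔ adjoinMap f u x = 0 := by
  simp [adjoinRel]

theorem adjoinRel_le (f : Subquotient D N →ₗ[R] A) (u : U) : adjoinRel f u ≤ adjoinLabel D u :=
  Submodule.map_subtype_le _ _

theorem le_adjoinRel (hND : N ≤ D) (f : Subquotient D N →ₗ[R] A) {u : U}
    (hu : ∀ d ∈ D, d u = 0) : N ≤ adjoinRel f u := fun n hn => by
  rw [mem_adjoinRel f ⟨n, le_adjoinLabel hu (hND hn)⟩, adjoinMap_of_mem f hu ⟨n, hND hn⟩,
    (Subquotient.mk_eq_zero _).2 hn, map_zero]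

/-- The enlarged module is isomorphic to the target of `f`. -/
noncomputable def adjoinEquiv (f : Subquotient D N →ₗ[R] A) (u : U) :
    Subquotient (adjoinLabel D u) (adjoinRel f u) ≃ₗ[R] A :=
  (Submodule.quotEquivOfEq _ _ (by
    ext x; exact mem_adjoinRel f x)).trans
    ((adjoinMap f u).quotKerEquivOfSurjective fun a => ⟨_, adjoinMap_single f u a⟩)

/-- The coordinate at `u₀` as a map to a subquotient. -/
noncomputable def labelMap {u₀ : U} (hD : ∀ a, Finsupp.single u₀ a ∈ D) (N : Submodule R (U →₀ A)) :
    A →ₗ[R] Subquotient D N :=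
  Subquotient.mk N ∘ₗ (Finsupp.lsingle u₀).codRestrict D hD

/-- The coordinate at `u₀` is an isomorphism onto its range. -/
noncomputable def labelEquiv (u₀ : U) :
    A ≃ₗ[R] Subquotient (LinearMap.range (Finsupp.lsingle u₀ : A →ₗ[R] U →₀ A)) ⊥ :=
  LinearEquiv.ofBijective
    (labelMap (D := LinearMap.range (Finsupp.lsingle u₀ : A →ₗ[R] U →₀ A)) (fun a => ⟨a, rfl⟩) ⊥) <| by
    constructor
    · refine (injective_iff_map_eq_zero _).2 fun a ha => ?_
      have : Finsupp.single u₀ a ∈ (⊥ : Submodule R (U →₀ A)) :=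
        (Subquotient.mk_eq_zero _).1 ha
      simpa using this
    · intro y
      obtain ⟨⟨_, a, rfl⟩, rfl⟩ := Subquotient.mk_surjective _ y
      exact ⟨a, rfl⟩

variable {P : Type v} [AddCommGroup P] [Module R P]

/-- A class of modules under `P` that is closed under direct limits and isomorphisms. -/
structure IsLimitClosed
    (𝒢 : ∀ (M : Type v) [AddCommGroup M] [Module R M], (P →ₗ[R] M) → Prop) : Prop where
  directLimit : ∀ {ι : Type v} [Preorder ι] [Nonempty ι] [IsDirectedOrder ι] {G : ι → Type v}
    [∀ i, AddCommGroup (G i)] [∀ i, Module R (G i)] {t : ∀ i j, i ≤ j → G i →ₗ[R] G j}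
    {M : Type v} [AddCommGroup M] [Module R M] {φ : ∀ i, G i →ₗ[R] M} {p : ∀ i, P →ₗ[R] G i}
    {q : P →ₗ[R] M}, IsDirectLimit t φ → (∀ i, 𝒢 (G i) (p i)) →
    (∀ i j (hij : i ≤ j) x, t i j hij (p i x) = p j x) → (∀ i x, φ i (p i x) = q x) → 𝒢 M q
  equiv : ∀ {M M' : Type v} [AddCommGroup M] [Module R M] [AddCommGroup M'] [Module R M']
    (e : M ≃ₗ[R] M') {p : P →ₗ[R] M} {p' : P →ₗ[R] M'}, (∀ x, e (p x) = p' x) → 𝒢 M p → 𝒢 M' p'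

/-- One cannot go on adjoining labels forever: a Zorn type argument over quotients of
submodules of a fixed direct sum of copies of `A`. -/
theorem IsLimitClosed.false_of_adjoin [Nontrivial A]
    {𝒢 : ∀ (M : Type v) [AddCommGroup M] [Module R M], (P →ₗ[R] M) → Prop}
    (h𝒢 : IsLimitClosed 𝒢) (i : P →ₗ[R] A) (hA : 𝒢 A i) (u₀ : U)
    (Inv : Submodule R (U →₀ A) → Submodule R (U →₀ A) → Prop)
    (hchain : ∀ (c : Set (Submodule R (U →₀ A) × Submodule R (U →₀ A))) (D N),
      IsChain (· ≤ ·) c → (∀ w, w ∈ D ↔ ∃ x ∈ c, w ∈ x.1) → (∀ w, w ∈ N ↔ ∃ x ∈ c, w ∈ x.2) →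
      (∀ x ∈ c, Inv x.1 x.2) → Inv D N)
    (hbase : Inv (LinearMap.range (Finsupp.lsingle u₀)) ⊥)
    (hstep : ∀ (D N : Submodule R (U →₀ A)) (hD : ∀ a, Finsupp.single u₀ a ∈ D), N ≤ D →
      𝒢 (Subquotient D N) (labelMap hD N ∘ₗ i) → Inv D N →
      ∃ f : Subquotient D N →ₗ[R] A, (∀ x, f (labelMap hD N (i x)) = i x) ∧
        ∃ u, (∀ d ∈ D, d u = 0) ∧ Inv (adjoinLabel D u) (adjoinRel f u)) : False := by
  let S : Set (Submodule R (U →₀ A) × Submodule R (U →₀ A)) :=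
    {x | x.2 ≤ x.1 ∧ (∃ hD : ∀ a, Finsupp.single u₀ a ∈ x.1,
      𝒢 (Subquotient x.1 x.2) (labelMap hD x.2 ∘ₗ i)) ∧ Inv x.1 x.2}
  obtain ⟨⟨D, N⟩, -, hmax⟩ := zorn_le_nonempty₀ S (by
    intro c hcS hc y hy
    have : Nonempty c := ⟨⟨y, hy⟩⟩
    have : IsDirectedOrder c := ⟨fun a b => by
      rcases hc.total a.2 b.2 with h | h
      · exact ⟨b, h, le_rfl⟩
      · exact ⟨a, le_rfl, h⟩⟩
    have hdir₁ : Directed (· ≤ ·) (fun x : c => x.1.1) := fun a b =>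
      (exists_ge_ge a b).imp fun _ h => ⟨h.1.1, h.2.1⟩
    have hdir₂ : Directed (· ≤ ·) (fun x : c => x.1.2) := fun a b =>
      (exists_ge_ge a b).imp fun _ h => ⟨h.1.2, h.2.2⟩
    let D : Submodule R (U →₀ A) := ⨆ x : c, x.1.1
    let N : Submodule R (U →₀ A) := ⨆ x : c, x.1.2
    have hD : ∀ w, w ∈ D ↔ ∃ x ∈ c, w ∈ x.1 := fun w => by
      rw [Submodule.mem_iSup_of_directed _ hdir₁]
      simp
    have hN : ∀ w, w ∈ N ↔ ∃ x ∈ c, w ∈ x.2 := fun w => by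
      rw [Submodule.mem_iSup_of_directed _ hdir₂]
      simp
    refine ⟨(D, N), ⟨?_, ⟨fun a => ?_, ?_⟩, ?_⟩, fun z hz => ⟨?_, ?_⟩⟩
    · intro w hw
      obtain ⟨x, hx, hwx⟩ := (hN w).1 hw
      exact (hD w).2 ⟨x, hx, (hcS hx).1 hwx⟩
    · exact (hD _).2 ⟨y, hy, (hcS hy).2.1.1 a⟩
    · exact h𝒢.directLimit (Subquotient.isDirectLimit c hD hN hc)
        (fun x => (hcS x.2).2.1.2) (fun _ _ _ _ => rfl) (fun _ _ => rfl)
    · exact hchain c D N hc hD hN fun x hx => (hcS hx).2.2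
    · exact fun w hw => (hD w).2 ⟨z, hz, hw⟩
    · exact fun w hw => (hN w).2 ⟨z, hz, hw⟩)
    (LinearMap.range (Finsupp.lsingle u₀), ⊥)
    ⟨bot_le, ⟨fun a => ⟨a, rfl⟩, h𝒢.equiv (labelEquiv u₀) (fun _ => rfl) hA⟩, hbase⟩
  obtain ⟨hND, ⟨hD, h𝒢D⟩, hInv⟩ := hmax.prop
  obtain ⟨f, hf, u, hu, hInv'⟩ := hstep D N hD hND h𝒢D hInv
  -- The enlarged pair is admissible, its subquotient being `A` again; maximality then puts the
  -- coordinate `u` inside `D`, where it must vanish.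
  have hle : (adjoinLabel D u, adjoinRel f u) ≤ (D, N) := by
    refine hmax.le_of_ge ⟨adjoinRel_le f u, ⟨fun a => le_adjoinLabel hu (hD a), ?_⟩, hInv'⟩
      ⟨le_adjoinLabel hu, le_adjoinRel hND f hu⟩
    refine h𝒢.equiv (adjoinEquiv f u).symm (fun x => ?_) hA
    rw [LinearEquiv.symm_apply_eq]
    refine ((adjoinMap_of_mem f hu ⟨_, hD (i x)⟩).trans (hf x)).symm
  obtain ⟨a, ha⟩ := exists_ne (0 : A)
  have := hu _ (hle.1 (single_mem_adjoinLabel u a))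
  simp [ha] at this

end Labelled

/-! ### Existence of pure hulls. -/

section Hull

variable {R : Type u} [Ring R] {K : ∀ (M : Type v) [AddCommGroup M] [Module R M], Prop}

/-- A class of modules that is closed under direct limits and pure submodules. -/
structure IsPureLimitClosed (K : ∀ (M : Type v) [AddCommGroup M] [Module R M], Prop) : Prop where
  directLimit : ∀ {ι : Type v} [Preorder ι] [Nonempty ι] [IsDirectedOrder ι] {G : ι → Type v}
    [∀ i, AddCommGroup (G i)] [∀ i, Module R (G i)] {t : ∀ i j, i ≤ j → G i →ₗ[R] G j}
    {M : Type v} [AddCommGroup M] [Module R M] {φ : ∀ i, G i →ₗ[R] M},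
    IsDirectLimit t φ → (∀ i, K (G i)) → K M
  of_pure : ∀ {X Y : Type v} [AddCommGroup X] [Module R X] [AddCommGroup Y] [Module R Y]
    {f : X →ₗ[R] Y}, IsPureEmbedding f → K Y → K X

variable {P : Type v} [AddCommGroup P] [Module R P]

/-- A pure extension `i : P → M` in `K` all of whose maps under `P` to pure extensions of `P` in
`K` are injective. -/
def IsRigidExtension (K : ∀ (M : Type v) [AddCommGroup M] [Module R M], Prop) (M : Type v)
    [AddCommGroup M] [Module R M] (i : P →ₗ[R] M) : Prop :=
  (K M ∧ IsPureEmbedding i) ∧ ∀ ⦃Z : Type v⦄ [AddCommGroup Z] [Module R Z] (j : P →ₗ[R] Z),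
    K Z → IsPureEmbedding j → ∀ t : M →ₗ[R] Z, (∀ x, t (i x) = j x) → Function.Injective t

theorem IsPureLimitClosed.isLimitClosed (hK : IsPureLimitClosed K) :
    IsLimitClosed (R := R) (P := P) (fun M _ _ i => K M ∧ IsPureEmbedding i) where
  directLimit h hp htp hq :=
    ⟨hK.directLimit h fun i => (hp i).1, h.isPureEmbedding (fun i => (hp i).2) htp hq⟩
  equiv e p p' hp h := by
    refine ⟨hK.of_pure (isPureEmbedding_of_leftInverse (f := e.symm.toLinearMap) e.toLinearMap
      (by simp)) h.1, ?_⟩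
    rw [show p' = e.toLinearMap ∘ₗ p from LinearMap.ext fun x => (hp x).symm]
    exact (isPureEmbedding_of_leftInverse (f := e.toLinearMap) e.symm.toLinearMap
      (by simp)).comp h.2

/-- A map out of a direct limit is injective once its restriction to each stage is, since every
element comes from a stage. -/
theorem IsPureLimitClosed.isLimitClosed_rigid (hK : IsPureLimitClosed K) :
    IsLimitClosed (R := R) (P := P) (fun M _ _ i => IsRigidExtension K M i) where
  directLimit {ι} _ _ _ {G} _ _ {t} {M} _ _ {φ} {p} {q} h hp htp hq := by
    refine ⟨hK.isLimitClosed.directLimit h (fun i => (hp i).1) htp hq, fun Z _ _ j hZ hj s hs => ?_⟩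
    refine (injective_iff_map_eq_zero s).2 fun y hy => ?_
    obtain ⟨k, x, rfl⟩ := h.exists_eq y
    have := (hp k).2 j hZ hj (s ∘ₗ φ k) (fun x => by simp [hq, hs])
    rw [(map_eq_zero_iff _ this).1 hy, map_zero]
  equiv e p p' hp h := by
    refine ⟨hK.isLimitClosed.equiv e hp h.1, fun Z _ _ j hZ hj s hs => ?_⟩
    have := h.2 j hZ hj (s ∘ₗ e.toLinearMap) (fun x => by simp [hp, hs])
    exact (Function.Injective.of_comp_iff' s e.bijective).1 this

variable {A : Type v} [AddCommGroup A] [Module R A] {i : P →ₗ[R] A}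

/-- Some endomorphism under `P` has the largest possible kernel. -/
theorem IsPureLimitClosed.exists_stable_endomorphism (hK : IsPureLimitClosed K) (hA : K A)
    (hi : IsPureEmbedding i)
    (hmap : ∀ ⦃M : Type v⦄ [AddCommGroup M] [Module R M] (j : P →ₗ[R] M), K M →
      IsPureEmbedding j → ∃ t : M →ₗ[R] A, ∀ x, t (j x) = i x) :
    ∃ h : A →ₗ[R] A, (∀ x, h (i x) = i x) ∧
      ∀ t : A →ₗ[R] A, (∀ x, t (i x) = i x) → ∀ a, t (h a) = 0 → h a = 0 := by
  by_contra! hcon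
  obtain ⟨-, -, a₀, -, ha₀⟩ := hcon LinearMap.id fun _ => rfl
  have : Nontrivial A := ⟨⟨a₀, 0, ha₀⟩⟩
  -- Labels are kernels: each step is labelled by the kernel of the original copy of `A` (label `⊥`)
  -- in the new one. The invariant says that every used label has died in the subquotient, so a
  -- strictly larger kernel is a fresh label.
  refine hK.isLimitClosed.false_of_adjoin (U := Submodule R A) i ⟨hA, hi⟩ ⊥
    (fun D N => ∀ d ∈ D, ∀ s : Submodule R A, d s ≠ 0 → ∀ a ∈ s, Finsupp.single ⊥ a ∈ N) ?_ ?_ ?_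
  · intro c D N _ hD hN h d hd s hs a ha
    obtain ⟨x, hx, hdx⟩ := (hD d).1 hd
    exact (hN _).2 ⟨x, hx, h x hx d hdx s hs a ha⟩
  · rintro _ ⟨b, rfl⟩ s hs a ha
    obtain rfl : s = ⊥ := by
      by_contra h
      exact hs (Finsupp.single_eq_of_ne h)
    simp [(Submodule.mem_bot R).1 ha]
  · intro D N hD hND hg hInv
    obtain ⟨t₀, ht₀⟩ := hmap _ hg.1 hg.2
    obtain ⟨t, ht, a, hta, ha⟩ := hcon (t₀ ∘ₗ labelMap hD N) ht₀
    let f := t ∘ₗ t₀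
    let u : Submodule R A := LinearMap.ker (f ∘ₗ labelMap hD N)
    have hu : ∀ d ∈ D, d u = 0 := by
      intro d hd
      by_contra h
      have h1 : labelMap hD N a = 0 :=
        (Subquotient.mk_eq_zero _).2 (hInv d hd u h a hta)
      exact ha (by rw [LinearMap.comp_apply, h1, map_zero])
    refine ⟨f, fun x => ?_, u, hu, fun d hd s hs b hb => ?_⟩
    · exact (congrArg t (ht₀ x)).trans (ht x)
    · by_cases hsu : s = u
      · subst hsu
        rw [mem_adjoinRel f ⟨_, le_adjoinLabel hu (hD b)⟩]
        exact (adjoinMap_of_mem f hu ⟨_, hD b⟩).trans hb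
      · refine le_adjoinRel hND f hu (hInv _ hd s ?_ b hb)
        rwa [eraseLinear_apply_ne hsu]

/-- The direct limit of the iterates of an endomorphism with stable kernel is rigid. -/
theorem IsPureLimitClosed.exists_rigid (hK : IsPureLimitClosed K) (hA : K A)
    (hi : IsPureEmbedding i)
    (hmap : ∀ ⦃M : Type v⦄ [AddCommGroup M] [Module R M] (j : P →ₗ[R] M), K M →
      IsPureEmbedding j → ∃ t : M →ₗ[R] A, ∀ x, t (j x) = i x) :
    ∃ (E : Type v) (_ : AddCommGroup E) (_ : Module R E) (j : P →ₗ[R] E),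
      IsRigidExtension K E j ∧ ∃ t : A →ₗ[R] E, ∀ x, t (i x) = j x := by
  classical
  obtain ⟨h, hhi, hh⟩ := hK.exists_stable_endomorphism hA hi hmap
  have hpow : ∀ n x, (h ^ n) (i x) = i x := fun n x => by
    induction n with
    | zero => rfl
    | succ n ih => rw [pow_succ, Module.End.mul_apply, hhi, ih]
  -- `ULift` puts the index set into the universe required by `IsLimitClosed`.
  let T : ∀ m n : ULift.{v} ℕ, m ≤ n → A →ₗ[R] A := fun m n _ => h ^ (n.down - m.down)
  have hT : ∀ l m n (hlm : l ≤ m) (hmn : m ≤ n) x, T m n hmn (T l m hlm x) =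
      T l n (hlm.trans hmn) x := by
    intro l m n hlm hmn x
    have h1 : l.down ≤ m.down := hlm
    have h2 : m.down ≤ n.down := hmn
    simp only [T]
    rw [← Module.End.mul_apply, ← pow_add]
    congr 2
    omega
  have : DirectedSystem (fun _ : ULift.{v} ℕ => A) (fun m n hmn => T m n hmn) :=
    { map_self := fun m x => by simp [T]
      map_map := fun _ _ _ hlm hmn x => hT _ _ _ hlm hmn x }
  have : IsDirectedOrder (ULift.{v} ℕ) :=
    ⟨fun a b => ⟨⟨max a.down b.down⟩, le_max_left a.down b.down, le_max_right a.down b.down⟩⟩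
  let E := Module.DirectLimit (fun _ : ULift.{v} ℕ => A) T
  let φ : ∀ n : ULift.{v} ℕ, A →ₗ[R] E := Module.DirectLimit.of R _ _ T
  have hφ : IsDirectLimit T φ :=
    { trans := hT
      comm := fun m n hmn x => Module.DirectLimit.of_f (hij := hmn)
      exists_eq := Module.DirectLimit.exists_of
      exists_eq_zero := fun m x hx => Module.DirectLimit.of.zero_exact hx }
  have hφi : ∀ n x, φ n (i x) = φ ⟨0⟩ (i x) := fun n x => by
    rw [← hφ.comm ⟨0⟩ n (Nat.zero_le n.down), hpow]
  have hgood : K E ∧ IsPureEmbedding (φ ⟨0⟩ ∘ₗ i) :=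
    hK.isLimitClosed.directLimit (p := fun _ => i) hφ (fun _ => ⟨hA, hi⟩)
      (fun _ _ _ x => hpow _ x) hφi
  refine ⟨E, inferInstance, inferInstance, φ ⟨0⟩ ∘ₗ i, ⟨hgood, fun Z _ _ j hZ hj s hs => ?_⟩,
    φ ⟨0⟩, fun x => rfl⟩
  obtain ⟨t, ht⟩ := hmap j hZ hj
  refine (injective_iff_map_eq_zero s).2 fun y hy => ?_
  obtain ⟨n, x, rfl⟩ := hφ.exists_eq y
  have hn : n ≤ ⟨n.down + 1⟩ := Nat.le_succ n.down
  have hstep : ∀ x, φ n x = φ ⟨n.down + 1⟩ (h x) := fun x => by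
    rw [← hφ.comm n _ hn]
    simp [T]
  -- Moving one stage up replaces `x` by `h x`. The endomorphism `t ∘ s ∘ φ` over `P` kills `h x`,
  -- so `h x = 0` by stability of the kernel.
  rw [hstep] at hy ⊢
  rw [hh (t ∘ₗ s ∘ₗ φ ⟨n.down + 1⟩) (fun x => ?_) x (by simp [hy]), map_zero]
  simp only [LinearMap.comp_apply, hφi]
  exact (congrArg t (hs x)).trans (ht x)

/-- Endomorphisms under `P` of a weakly terminal rigid extension are surjective. -/
theorem IsPureLimitClosed.surjective_of_rigid (hK : IsPureLimitClosed K)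
    (hA : IsRigidExtension K A i)
    (hmap : ∀ ⦃M : Type v⦄ [AddCommGroup M] [Module R M] (j : P →ₗ[R] M), K M →
      IsPureEmbedding j → ∃ t : M →ₗ[R] A, ∀ x, t (j x) = i x)
    (h : A →ₗ[R] A) (hh : ∀ x, h (i x) = i x) : Function.Surjective h := by
  intro a₀
  by_contra hcon
  have ha₀ : a₀ ≠ 0 := by
    rintro rfl
    exact hcon ⟨0, map_zero h⟩
  have : Nontrivial A := ⟨⟨a₀, 0, ha₀⟩⟩
  -- The invariant keeps the copies of `a₀` at different used labels distinct modulo `N`. Each step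
  -- maps into the new copy of `A` through `h`, whose range misses `a₀`, so the new `a₀` differs
  -- from all earlier ones.
  refine hK.isLimitClosed_rigid.false_of_adjoin (U := Set A) i hA ∅
    (fun D N => (∀ d ∈ D, ∀ s : Set A, d s ≠ 0 → Finsupp.single s a₀ ∈ D) ∧
      ∀ s s' : Set A, Finsupp.single s a₀ ∈ D → Finsupp.single s' a₀ ∈ D →
        Finsupp.single s a₀ - Finsupp.single s' a₀ ∈ N → s = s') ?_ ?_ ?_
  · intro c D N hc hD hN hInv
    refine ⟨fun d hd s hs => ?_, fun s s' hs hs' hss => ?_⟩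
    · obtain ⟨x, hx, hdx⟩ := (hD d).1 hd
      exact (hD _).2 ⟨x, hx, (hInv x hx).1 d hdx s hs⟩
    · obtain ⟨x, hx, hsx⟩ := (hD _).1 hs
      obtain ⟨y, hy, hsy⟩ := (hD _).1 hs'
      obtain ⟨z, hz, hsz⟩ := (hN _).1 hss
      obtain ⟨w, hw, hxw, hyw⟩ := hc.directedOn x hx y hy
      obtain ⟨w', hw', hww', hzw'⟩ := hc.directedOn w hw z hz
      exact (hInv w' hw').2 s s' (hww'.1 (hxw.1 hsx)) (hww'.1 (hyw.1 hsy)) (hzw'.2 hsz)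
  · have hmem : ∀ s : Set A, Finsupp.single s a₀ ∈
        LinearMap.range (Finsupp.lsingle ∅ : A →ₗ[R] Set A →₀ A) → s = ∅ := by
      rintro s ⟨b, hb⟩
      by_contra hs
      have := DFunLike.congr_fun hb s
      simp [Finsupp.single_eq_of_ne hs] at this
      exact ha₀ this.symm
    refine ⟨?_, fun s s' hs hs' _ => (hmem s hs).trans (hmem s' hs').symm⟩
    rintro _ ⟨b, rfl⟩ s hs
    obtain rfl : s = ∅ := by
      by_contra h
      exact hs (Finsupp.single_eq_of_ne h)
    exact ⟨a₀, rfl⟩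
  · intro D N hD hND hg hInv
    obtain ⟨t, ht⟩ := hmap _ hg.1.1 hg.1.2
    let f := h ∘ₗ t
    have hf : ∀ x, f (labelMap hD N (i x)) = i x := fun x => (congrArg h (ht x)).trans (hh x)
    have hfinj : Function.Injective f := hg.2 i hA.1.1 hA.1.2 f hf
    have hfa : ∀ y, f y ≠ a₀ := fun y hy => hcon ⟨t y, hy⟩
    -- The used labels inject into `A` through `f`, so by Cantor they cannot exhaust `Set A`.
    obtain ⟨u, hu⟩ : ∃ u : Set A, Finsupp.single u a₀ ∉ D := by
      by_contra! hall
      refine Function.cantor_injective (fun s => f (Subquotient.mk N ⟨_, hall s⟩))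
        fun s s' hss => hInv.2 s s' (hall s) (hall s') ?_
      have := hfinj hss
      rwa [← sub_eq_zero, ← map_sub, Subquotient.mk_eq_zero] at this
    have hu0 : ∀ d ∈ D, d u = 0 := fun d hd => by
      by_contra hdu
      exact hu (hInv.1 d hd u hdu)
    have hmem : ∀ s, s ≠ u → Finsupp.single s a₀ ∈ adjoinLabel D u → Finsupp.single s a₀ ∈ D := by
      intro s hs h
      have h' : eraseLinear R A u (Finsupp.single s a₀) ∈ D := h
      rwa [eraseLinear_of_eq_zero (Finsupp.single_eq_of_ne hs.symm)] at h'
    have key : ∀ s, s ≠ u → Finsupp.single s a₀ ∈ adjoinLabel D u →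
        Finsupp.single s a₀ - Finsupp.single u a₀ ∉ adjoinRel f u := by
      intro s hs hsD hsu
      have h1 := (mem_adjoinRel f (⟨_, hsD⟩ - ⟨_, single_mem_adjoinLabel u a₀⟩)).1 hsu
      rw [map_sub, adjoinMap_single, sub_eq_zero] at h1
      exact hfa _ ((adjoinMap_of_mem f hu0 ⟨_, hmem s hs hsD⟩).symm.trans h1)
    refine ⟨f, hf, u, hu0, fun d hd s hs => ?_, fun s s' hs hs' hss => ?_⟩
    · by_cases hsu : s = u
      · subst hsu
        exact single_mem_adjoinLabel s a₀
      · refine le_adjoinLabel hu0 (hInv.1 _ hd s ?_)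
        rwa [eraseLinear_apply_ne hsu]
    · by_cases hsu : s = u <;> by_cases hsu' : s' = u
      · rw [hsu, hsu']
      · subst hsu
        rw [← neg_mem_iff, neg_sub] at hss
        exact absurd hss (key s' hsu' hs')
      · subst hsu'
        exact absurd hss (key s hsu hs)
      · have hsD := hmem s hsu hs
        have hsD' := hmem s' hsu' hs'
        refine hInv.2 s s' hsD hsD' ?_
        have h1 := (mem_adjoinRel f ⟨_, le_adjoinLabel hu0 (D.sub_mem hsD hsD')⟩).1 hss
        rw [adjoinMap_of_mem f hu0 ⟨_, D.sub_mem hsD hsD'⟩] at h1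
        exact (Subquotient.mk_eq_zero _).1 ((map_eq_zero_iff f hfinj).1 h1)

/-- A pure extension in `K` to which all others map and whose endomorphisms under `P` are
automorphisms. -/
structure IsPureHull (K : ∀ (M : Type v) [AddCommGroup M] [Module R M], Prop) (E : Type v)
    [AddCommGroup E] [Module R E] (i : P →ₗ[R] E) : Prop where
  mem : K E
  pure : IsPureEmbedding i
  exists_map : ∀ ⦃M : Type v⦄ [AddCommGroup M] [Module R M] (j : P →ₗ[R] M), K M →
    IsPureEmbedding j → ∃ t : M →ₗ[R] E, ∀ x, t (j x) = i x
  bijective : ∀ h : E →ₗ[R] E, (∀ x, h (i x) = i x) → Function.Bijective h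

/-- Injectivity relative to pure embeddings between members of `K`. -/
abbrev IsPureInjectiveIn (K : ∀ (M : Type v) [AddCommGroup M] [Module R M], Prop) (E : Type v)
    [AddCommGroup E] [Module R E] : Prop :=
  IsRelInjective (R := R) K (fun f => IsPureEmbedding f) E

/-- A module with a pure embedding into a module that is pure injective in `K` has a hull. -/
theorem IsPureLimitClosed.exists_hull (hK : IsPureLimitClosed K) (hA : IsPureInjectiveIn K A)
    (hi : IsPureEmbedding i) :
    ∃ (E : Type v) (_ : AddCommGroup E) (_ : Module R E) (j : P →ₗ[R] E), IsPureHull K E j := by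
  have hmap : ∀ ⦃M : Type v⦄ [AddCommGroup M] [Module R M] (j : P →ₗ[R] M), K M →
      IsPureEmbedding j → ∃ t : M →ₗ[R] A, ∀ x, t (j x) = i x := fun M _ _ j hM hj =>
    -- `P` lies in `K` as a pure submodule of `A`.
    (hA.2 j (hK.of_pure hi hA.1) hM hj i).imp fun t ht x => DFunLike.congr_fun ht x
  obtain ⟨E, _, _, j, hE, s, hs⟩ := hK.exists_rigid hA.1 hi hmap
  have hmapE : ∀ ⦃M : Type v⦄ [AddCommGroup M] [Module R M] (k : P →ₗ[R] M), K M →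
      IsPureEmbedding k → ∃ t : M →ₗ[R] E, ∀ x, t (k x) = j x := fun M _ _ k hM hk => by
    obtain ⟨t, ht⟩ := hmap k hM hk
    exact ⟨s ∘ₗ t, fun x => by simp [ht, hs]⟩
  exact ⟨E, inferInstance, inferInstance, j, hE.1.1, hE.1.2, hmapE, fun h hh =>
    ⟨hE.2 j hE.1.1 hE.1.2 h hh, hK.surjective_of_rigid hE hmapE h hh⟩⟩

end Hull

/-! ### The Schröder–Bernstein argument. -/

section SchroederBernstein

variable {R : Type u} [Ring R] {K : ∀ (M : Type v) [AddCommGroup M] [Module R M], Prop}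

theorem IsPureEmbedding.of_comp {X Y Z : Type v} [AddCommGroup X] [Module R X] [AddCommGroup Y]
    [Module R Y] [AddCommGroup Z] [Module R Z] {g : Y →ₗ[R] Z} {f : X →ₗ[R] Y}
    (h : IsPureEmbedding (g ∘ₗ f)) : IsPureEmbedding f := by
  refine isPureEmbedding_of_forall_exists (Function.Injective.of_comp h.1)
    fun m n r a y hy => h.exists_solution r a (fun j => g (y j)) fun i => ?_
  rw [LinearMap.comp_apply, ← hy i, map_sum]
  simp

/-- The codomain of a split monomorphism decomposes as a product. -/
def LinearMap.prodKerEquivOfLeftInverse {X Y : Type*} [AddCommGroup X] [Module R X]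
    [AddCommGroup Y] [Module R Y] (f : X →ₗ[R] Y) (r : Y →ₗ[R] X) (h : ∀ x, r (f x) = x) :
    Y ≃ₗ[R] X × LinearMap.ker r where
  toFun y := (r y, ⟨y - f (r y), by simp [h]⟩)
  map_add' a b := by ext <;> simp; abel
  map_smul' c a := by ext <;> simp [smul_sub]
  invFun z := f z.1 + z.2
  left_inv y := by simp
  right_inv z := by
    have : r z.2 = 0 := z.2.2
    ext <;> simp [h, this]

/-- Adding a summand `C` to a hull of `C ⊕ C ⊕ ⋯` does not change it: maps of pure extensions
in both directions between a hull and its sum with `C` are isomorphisms. -/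
theorem IsPureHull.bijective_of_prod {C E : Type v} [AddCommGroup C] [Module R C]
    [AddCommGroup E] [Module R E] {i : (ℕ →₀ C) →ₗ[R] E} (hE : IsPureHull K E i)
    {i' : (ℕ →₀ C) →ₗ[R] C × E} (h₀ : ∀ c, i' (Finsupp.single 0 c) = (c, 0))
    (h₁ : ∀ y, i' (y.mapDomain Nat.succ) = (0, i y)) (k : C × E →ₗ[R] C × E)
    (hk : ∀ x, k (i' x) = i' x) : Function.Bijective k := by
  have hC : ∀ c, k (c, 0) = (c, 0) := fun c => by rw [← h₀, hk]
  let h : E →ₗ[R] E := LinearMap.snd R C E ∘ₗ k ∘ₗ LinearMap.inr R C E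
  have hh : Function.Bijective h := hE.bijective h fun y => by
    simp only [h, LinearMap.comp_apply, LinearMap.inr_apply]
    rw [← h₁, hk, h₁, LinearMap.snd_apply]
  -- `k` is triangular, with the identity of `C` and the automorphism `h` of `E` on the diagonal.
  have hke : ∀ c e, k (c, e) = (c + (k (0, e)).1, h e) := fun c e => by
    have : ((c, e) : C × E) = (c, 0) + (0, e) := by simp
    rw [this, map_add, hC]
    ext <;> simp [h]
  constructor
  · refine (injective_iff_map_eq_zero k).2 ?_
    rintro ⟨c, e⟩ hce
    rw [hke, Prod.mk_eq_zero] at hce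
    obtain rfl : e = 0 := (map_eq_zero_iff h hh.1).1 hce.2
    have : c = 0 := by
      have h0 : k ((0 : C), (0 : E)) = 0 := map_zero k
      simpa [h0] using hce.1
    simp [this]
  · rintro ⟨c, e⟩
    obtain ⟨e, rfl⟩ := hh.2 e
    exact ⟨(c - (k (0, e)).1, e), by rw [hke, sub_add_cancel]⟩

variable {A B : Type v} [AddCommGroup A] [Module R A] [AddCommGroup B] [Module R B]

theorem IsPureInjectiveIn.exists_leftInverse (hA : IsPureInjectiveIn K A) (hB : K B)
    {f : A →ₗ[R] B} (hf : IsPureEmbedding f) : ∃ r : B →ₗ[R] A, ∀ x, r (f x) = x :=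
  (hA.2 f hA.1 hB hf LinearMap.id).imp fun _ h x => DFunLike.congr_fun h x

/-- The orbit of `C` under `φ` as a map from a direct sum of copies of `C`. -/
noncomputable def orbitMap (φ : A →ₗ[R] A) (C : Submodule R A) : (ℕ →₀ C) →ₗ[R] A :=
  Finsupp.lsum ℕ fun n => (φ ^ n : Module.End R A) ∘ₗ C.subtype

@[simp] theorem orbitMap_single (φ : A →ₗ[R] A) (C : Submodule R A) (n : ℕ) (c : C) :
    orbitMap φ C (Finsupp.single n c) = (φ ^ n : Module.End R A) c := by
  simp [orbitMap]

theorem orbitMap_mapDomain_succ (φ : A →ₗ[R] A) (C : Submodule R A) (x : ℕ →₀ C) :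
    orbitMap φ C (x.mapDomain Nat.succ) = φ (orbitMap φ C x) := by
  have : orbitMap φ C ∘ₗ Finsupp.lmapDomain C R Nat.succ = φ ∘ₗ orbitMap φ C := by
    ext n c
    simp [pow_succ', Module.End.mul_apply]
  exact DFunLike.congr_fun this x

/-- `ρ ∘ ψ ^ n` reads off the `n`-th coordinate. All coordinates together would only map to a
product, but finitely many give a retraction over any finite set, which suffices for purity. -/
theorem isPureEmbedding_orbitMap {φ ψ : A →ₗ[R] A} {C : Submodule R A} {ρ : A →ₗ[R] C}
    (hψφ : ∀ a, ψ (φ a) = a) (hψ : ∀ c : C, ψ c = 0) (hρφ : ∀ a, ρ (φ a) = 0)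
    (hρ : ∀ c : C, ρ c = c) : IsPureEmbedding (orbitMap φ C) := by
  have hcoord : ∀ n x, ρ ((ψ ^ n : Module.End R A) (orbitMap φ C x)) = x n := by
    intro n
    induction n with
    | zero =>
      intro x
      have : ρ ∘ₗ orbitMap φ C = Finsupp.lapply 0 := by
        ext m c : 2
        cases m with
        | zero => simp [hρ]
        | succ m => simp [pow_succ', Module.End.mul_apply, hρφ]
      exact DFunLike.congr_fun this x
    | succ n ih =>
      intro x
      have : ρ ∘ₗ (ψ ^ (n + 1) : Module.End R A) ∘ₗ orbitMap φ C = Finsupp.lapply (n + 1) := by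
        ext m c : 2
        cases m with
        | zero => simp [pow_succ, Module.End.mul_apply, hψ]
        | succ m =>
          have := ih (Finsupp.single m c)
          rw [orbitMap_single] at this
          simp [pow_succ ψ, pow_succ' φ, Module.End.mul_apply, hψφ, this, Finsupp.single_apply]
      exact DFunLike.congr_fun this x
  refine isPureEmbedding_of_locally_split fun s => ?_
  refine ⟨∑ n ∈ s.biUnion Finsupp.support,
    Finsupp.lsingle n ∘ₗ ρ ∘ₗ (ψ ^ n : Module.End R A), fun x hx => ?_⟩
  simp only [LinearMap.sum_apply, LinearMap.comp_apply, hcoord, Finsupp.lsingle_apply]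
  rw [← Finsupp.sum_of_support_subset x (Finset.subset_biUnion_of_mem Finsupp.support hx)
    (fun n c => Finsupp.single n c) (by simp), Finsupp.sum_single]

/-- The Schröder–Bernstein property for pure embeddings of modules that are pure injective in a
class closed under direct limits and pure submodules. -/
theorem IsPureLimitClosed.nonempty_linearEquiv (hK : IsPureLimitClosed K)
    (hA : IsPureInjectiveIn K A) (hB : IsPureInjectiveIn K B) {f : A →ₗ[R] B}
    (hf : IsPureEmbedding f) {g : B →ₗ[R] A} (hg : IsPureEmbedding g) :
    Nonempty (A ≃ₗ[R] B) := by
  obtain ⟨f', hf'⟩ := hA.exists_leftInverse hB.1 hf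
  obtain ⟨g', hg'⟩ := hB.exists_leftInverse hA.1 hg
  let C := LinearMap.ker g'
  let eA : A ≃ₗ[R] B × C := g.prodKerEquivOfLeftInverse g' hg'
  let ρ : A →ₗ[R] C := LinearMap.snd R B C ∘ₗ eA.toLinearMap
  have hgC : ∀ c : C, g' c = 0 := fun c => c.2
  have hρg : ∀ b, ρ (g b) = 0 := fun b => Subtype.ext (by
    change g b - g (g' (g b)) = 0
    rw [hg', sub_self])
  have hρC : ∀ c : C, ρ c = c := fun c => Subtype.ext (by
    change (c : A) - g (g' c) = c
    rw [hgC, map_zero, sub_zero])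
  let p : (ℕ →₀ C) →ₗ[R] A := orbitMap (g ∘ₗ f) C
  have hp : IsPureEmbedding p := isPureEmbedding_orbitMap (ψ := f' ∘ₗ g') (ρ := ρ)
    (fun a => by simp [hg', hf']) (fun c => by simp [hgC]) (fun a => hρg _) hρC
  have hp₀ : ∀ c : C, p (Finsupp.single 0 c) = c := fun c => by simp [p]
  have hp₁ : ∀ y, p (y.mapDomain Nat.succ) = g (f (p y)) := orbitMap_mapDomain_succ _ _
  have hP : K (ℕ →₀ C) := hK.of_pure hp hA.1
  obtain ⟨E, _, _, i, hE⟩ := hK.exists_hull hA hp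
  obtain ⟨q, hq⟩ := hA.2 i hP hE.mem hE.pure p
  obtain ⟨u, hu⟩ := hB.2 i hP hE.mem hE.pure (f ∘ₗ p)
  obtain ⟨v, hv⟩ := hE.exists_map (f ∘ₗ p) hB.1 (hf.comp hp)
  replace hq : ∀ x, q (i x) = p x := DFunLike.congr_fun hq
  replace hu : ∀ x, u (i x) = f (p x) := DFunLike.congr_fun hu
  replace hv : ∀ x, v (f (p x)) = i x := hv
  -- `v ∘ u` fixes `P`, hence is an automorphism of the hull; correcting `v` by its inverse splits
  -- `u`.
  let e := LinearEquiv.ofBijective (v ∘ₗ u) (hE.bijective _ fun x => by simp [hu, hv])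
  let u' : B →ₗ[R] E := e.symm.toLinearMap ∘ₗ v
  have hu' : ∀ x, u' (u x) = x := fun x => e.symm_apply_apply x
  -- On `P` this is the shift `P ≅ C ⊕ P`: coordinate `0` goes to `C`, and the others move down by
  -- one.
  let α : E →ₗ[R] C × E := (ρ ∘ₗ q).prod (v ∘ₗ g' ∘ₗ q)
  let i' : (ℕ →₀ C) →ₗ[R] C × E := α ∘ₗ i
  have h₀ : ∀ c, i' (Finsupp.single 0 c) = (c, 0) := fun c => by
    simp [i', α, hq, hp₀, hρC, hgC]
  have h₁ : ∀ y, i' (y.mapDomain Nat.succ) = (0, i y) := fun y => by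
    simp [i', α, hq, hp₁, hρg, hg', hv]
  -- Embedding `C × E` as a summand of `A` shows that it lies in `K` and that `i'` is pure, so the
  -- hull property applies to `i'`.
  let w : C × E →ₗ[R] A := C.subtype.coprod (g ∘ₗ u)
  have hw : IsPureEmbedding w := isPureEmbedding_of_leftInverse (ρ.prod (u' ∘ₗ g')) fun x => by
    simp [w, hρC, hρg, hgC, hg', hu']
  have hwi : w ∘ₗ i' = p := by
    ext n c : 2
    cases n with
    | zero => simp [h₀, hp₀, w]
    | succ n =>
      have : Finsupp.single (n + 1) c = (Finsupp.single n c).mapDomain Nat.succ := by simp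
      simp only [LinearMap.comp_apply, Finsupp.lsingle_apply]
      rw [this, h₁, hp₁]
      simp [w, hu]
  obtain ⟨β, hβ⟩ := hE.exists_map i' (hK.of_pure hw hA.1)
    (IsPureEmbedding.of_comp (g := w) (by rwa [hwi]))
  have hβα : Function.Bijective (β ∘ₗ α) := hE.bijective _ hβ
  have hαβ : Function.Bijective (α ∘ₗ β) := hE.bijective_of_prod h₀ h₁ _ fun x => by
    rw [LinearMap.comp_apply, hβ]; rfl
  let eE : E ≃ₗ[R] C × E := LinearEquiv.ofBijective α
    ⟨Function.Injective.of_comp (f := β) hβα.1, Function.Surjective.of_comp (g := β) hαβ.2⟩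
  let D := LinearMap.ker u'
  let eB : B ≃ₗ[R] E × D := u.prodKerEquivOfLeftInverse u' hu'
  -- `A ≅ B × C ≅ C × B ≅ C × (E × D) ≅ (C × E) × D ≅ E × D ≅ B`.
  exact ⟨eA ≪≫ₗ LinearEquiv.prodComm R B C ≪≫ₗ (LinearEquiv.refl R C).prodCongr eB ≪≫ₗ
    (LinearEquiv.prodAssoc R C E D).symm ≪≫ₗ eE.symm.prodCongr (LinearEquiv.refl R D) ≪≫ₗ eB.symm⟩

end SchroederBernstein

/-! ### The flat cotorsion and the 𝔰-torsion cases. -/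

theorem isPureLimitClosed_isFlatModule (R : Type u) [Ring R] :
    IsPureLimitClosed (R := R) (fun (M : Type v) _ _ => IsFlatModule R M) where
  directLimit h hG := h.isFlatModule hG
  of_pure hf hY := IsFlatModule.of_pure hf hY

theorem isPureLimitClosed_isSTorsionModule (R : Type u) [Ring R] :
    IsPureLimitClosed (R := R) (fun (M : Type v) _ _ => IsSTorsionModule R M) where
  directLimit h hG := h.isSTorsionModule hG
  of_pure hf hY := IsSTorsionModule.of_pure hf hY

open Abelian in
/-- Homomorphisms to a cotorsion module extend along pure embeddings into flat modules. -/
theorem IsCotorsionModule.exists_extension {R : Type u} [Ring R] [Small.{v} R]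
    {M X Y : Type v} [AddCommGroup M] [Module R M] [AddCommGroup X] [Module R X]
    [AddCommGroup Y] [Module R Y] (hM : IsCotorsionModule R M) (hY : IsFlatModule R Y)
    {f : X →ₗ[R] Y} (hf : IsPureEmbedding f) (g : X →ₗ[R] M) : ∃ h : Y →ₗ[R] M, h ∘ₗ f = g := by
  let q := (LinearMap.range f).mkQ
  have hq : Function.Surjective q := Submodule.mkQ_surjective _
  have hfq : Function.Exact f q := LinearMap.exact_map_mkQ_range f
  have := hM _ (IsFlatModule.of_pure_quotient hf hq hfq hY)
  let S : ShortComplex (ModuleCat.{v} R) := ShortComplex.mk (ModuleCat.ofHom f) (ModuleCat.ofHom q)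
    (by rw [← ModuleCat.ofHom_comp, hfq.linearMap_comp_eq_zero]; rfl)
  have hS : S.ShortExact := ModuleCat.shortComplex_shortExact S hfq hf.1 hq
  -- The obstruction to extending `g` lies in `Ext¹` of the flat cokernel with values in `M`, which
  -- vanishes.
  obtain ⟨x, hx⟩ := Ext.contravariant_sequence_exact₁ hS (ModuleCat.of R M)
    (Ext.mk₀ (ModuleCat.ofHom g)) (add_zero 1) (Subsingleton.elim _ _)
  obtain ⟨h, rfl⟩ := (Ext.mk₀_bijective _ _).2 x
  rw [Ext.mk₀_comp_mk₀] at hx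
  exact ⟨h.hom, congrArg ModuleCat.Hom.hom ((Ext.mk₀_bijective _ _).1 hx)⟩

theorem corollary3p5 (R : Type u) [Ring R] [Small.{v} R]
    (A B : Type v) [AddCommGroup A] [Module R A] [AddCommGroup B] [Module R B]
    (hAB : (IsFlatModule R A ∧ IsCotorsionModule R A ∧ IsFlatModule R B ∧ IsCotorsionModule R B) ∨
      (IsSTorPureInjective R A ∧ IsSTorPureInjective R B))
    (f : A →ₗ[R] B) (hf : IsPureEmbedding f) (g : B →ₗ[R] A) (hg : IsPureEmbedding g) :
    Nonempty (A ≃ₗ[R] B) := by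
  rcases hAB with ⟨hA, hA', hB, hB'⟩ | ⟨hA, hB⟩
  · exact (isPureLimitClosed_isFlatModule R).nonempty_linearEquiv
      ⟨hA, fun _ _ _ _ _ _ _ _ hY hi k => hA'.exists_extension hY hi k⟩
      ⟨hB, fun _ _ _ _ _ _ _ _ hY hi k => hB'.exists_extension hY hi k⟩ hf hg
  · exact (isPureLimitClosed_isSTorsionModule R).nonempty_linearEquiv hA hB hf hg
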